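/- **Theorem 2.9.** Let $G$ be a finite dimensional second countable real Lie group, let $\rho: G\to U(\mathbf H)$ be a unitary representation on a complex Hilbert space $\mathbf H$ such that $g\mapsto\rho(g)x$ is continuous for each $x\in\mathbf H$, and let $\mathbf H_\infty\subset\mathbf H$ be the space of smooth vectors, i.e. of those $x$ for which $g\mapsto \rho(g)x$, $G\to \mathbf H$, is smooth. Equip $\mathbf H_\infty$ with the (Fréchet) topology induced by the embedding $x\mapsto(g\mapsto\rho(g)x)$ into $C^\infty(G,\mathbf H)$, where $C^\infty(G,\mathbf H)$ carries the topology of uniform convergence on compact sets in all derivatives separately. Let $\omega=\operatorname{Im}\langle\cdot,\cdot\rangle$ be the imaginary part of the Hermitian inner product (linear in the first variable), restricted to $\mathbf H_\infty$ and regarded as a constant weak symplectic form with injective map $\check\omega:\mathbf H_\infty\to\mathbf H_\infty'=L(\mathbf H_\infty,\mathbb R)$, $\check\omega(x)=\omega(x,\cdot)$, whose image $\mathbf H_\infty^*$ is called the smooth dual. A curve in a locally convex space is smooth if all its derivatives exist and are continuous; a mapping is smooth if it maps smooth curves to smooth curves; and $df(x)v=\lim_{t\to0}(f(x+tv)-f(x))/t$.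 A smooth $1$-form on $\mathbf H_\infty$ is a map $\alpha:\mathbf H_\infty\to\mathbf H_\infty'$ for which $(x,v)\mapsto\alpha(x)v$ is smooth. Let * $C^\infty_*(\mathbf H_\infty,\mathbb R)$ be the space of all smooth $f:\mathbf H_\infty\to\mathbb R$ such that for every $k\ge1$ and all $x,y_2,\dots,y_k\in\mathbf H_\infty$ one has $d^kf(x)(\cdot,y_2,\dots,y_k)\in\mathbf H_\infty^*$, and such that $(x,y_2,\dots,y_k)\mapsto\check\omega^{-1}(d^kf(x)(\cdot,y_2,\dots,y_k))$, $\prod^k\mathbf H_\infty\to\mathbf H_\infty$, is smooth; * $\mathfrak X_\omega(\mathbf H_\infty)$ be the space of all smooth vector fields $\xi:\mathbf H_\infty\to\mathbf H_\infty$ with $\mathcal L_\xi\omega=0$, with the bracket $[\xi,\eta](x)=d\eta(x)\xi(x)-d\xi(x)\eta(x)$; * $H^0(\mathbf H_\infty)$ be the space of smooth functions $f:\mathbf H_\infty\to\mathbb R$ with $df=0$, and $H^1(\mathbf H_\infty)$ the space of closed smooth $1$-forms modulo the exact ones (differentials of smooth functions); both carry the zero bracket. Then the following hold. 1. The mapping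 $\operatorname{grad}:C^\infty_*(\mathbf H_\infty,\mathbb R)\to\mathfrak X_\omega(\mathbf H_\infty)$, $\operatorname{grad}f:=\check\omega^{-1}\circ df$, is well defined (and linear). 2. The Poisson bracket $\{f,g\}:=\omega(\operatorname{grad}g,\operatorname{grad}f)=dg(\operatorname{grad}f)$ is well defined as a mapping $C^\infty_*(\mathbf H_\infty,\mathbb R)\times C^\infty_*(\mathbf H_\infty,\mathbb R)\to C^\infty_*(\mathbf H_\infty,\mathbb R)$ and makes $C^\infty_*(\mathbf H_\infty,\mathbb R)$ a real Lie algebra. 3. $\mathfrak X_\omega(\mathbf H_\infty)$ is a real Lie algebra, $H^0(\mathbf H_\infty)\subset C^\infty_*(\mathbf H_\infty,\mathbb R)$, and with $\gamma(\xi)=[i_\xi\omega]$ the sequence $$0\to H^0(\mathbf H_\infty)\to C^\infty_*(\mathbf H_\infty,\mathbb R)\xrightarrow{\ \operatorname{grad}\ }\mathfrak X_\omega(\mathbf H_\infty)\xrightarrow{\ \gamma\ }H^1(\mathbf H_\infty)=0$$ is an exact sequence of Lie algebras and Lie algebra homomorphisms. -/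

import Mathlib

open Filter Topology
open scoped Manifold

noncomputable section

namespace UnitaryMoment

/-! ## Smooth calculus along curves -/

section Calculus

set_option linter.unusedSectionVars false

variable {V W : Type*} [AddCommGroup V] [Module ℝ V] [TopologicalSpace V]
  [AddCommGroup W] [Module ℝ W] [TopologicalSpace W]

/-- The curve `c` is differentiable at `t` with derivative `v`. -/
def HasCurveDerivAt (c : ℝ → V) (v : V) (t : ℝ) : Prop :=
  Tendsto (fun s : ℝ => s⁻¹ • (c (t + s) - c t)) (𝓝[≠] 0) (𝓝 v)

/-- A curve is smooth if all its derivatives (listed here as `D 0 = c`, `D 1`, `D 2`, …)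
exist and are continuous. -/
def IsSmoothCurve (c : ℝ → V) : Prop :=
  ∃ D : ℕ → ℝ → V, D 0 = c ∧
    ∀ n, Continuous (D n) ∧ ∀ t, HasCurveDerivAt (D n) (D (n + 1) t) t

/-- A mapping is smooth (in the sense of Frölicher and Kriegl) if it maps smooth curves to
smooth curves. -/
def IsSmoothMap (f : V → W) : Prop :=
  ∀ c : ℝ → V, IsSmoothCurve c → IsSmoothCurve (f ∘ c)

/-- `df(x)v = lim_{t → 0} (f(x + tv) - f(x)) / t`. -/
def dirDeriv (f : V → W) (x v : V) : W :=
  limUnder (𝓝[≠] (0 : ℝ)) fun t : ℝ => t⁻¹ • (f (x + t • v) - f x)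

/-- The iterated derivative `dᵏf(x)(y₁, …, yₖ)`, where `y₁` is the direction of the last
differentiation. -/
def iterDeriv (f : V → W) : (k : ℕ) → V → (Fin k → V) → W
  | 0, x, _ => f x
  | k + 1, x, y => dirDeriv (fun x' => iterDeriv f k x' (Fin.tail y)) x (y 0)

theorem IsSmoothCurve.exists_deriv {c : ℝ → V} (hc : IsSmoothCurve c) (t : ℝ) :
    ∃ v, HasCurveDerivAt c v t := by
  obtain ⟨D, rfl, hD⟩ := hc
  exact ⟨_, (hD 0).2 t⟩

theorem isSmoothCurve_const (v : V) : IsSmoothCurve (fun _ : ℝ => v) := by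
  refine ⟨fun n _ => if n = 0 then v else 0, by simp, fun n => ⟨continuous_const, fun t => ?_⟩⟩
  simpa [HasCurveDerivAt] using tendsto_const_nhds

theorem isSmoothCurve_line [IsTopologicalAddGroup V] [ContinuousSMul ℝ V] (x v : V) :
    IsSmoothCurve (fun t : ℝ => x + t • v) := by
  refine ⟨fun n t => if n = 0 then x + t • v else if n = 1 then v else 0, by simp,
    fun n => ⟨?_, fun t => ?_⟩⟩
  · rcases n with _ | n
    · simp only [if_true]
      fun_prop
    · simp only [Nat.succ_ne_zero, if_false]
      exact continuous_const
  · rcases n with _ | n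
    · simp only [if_true, HasCurveDerivAt]
      refine tendsto_const_nhds.congr' ?_
      filter_upwards [self_mem_nhdsWithin] with s hs
      have hs' : s ≠ 0 := hs
      simp [add_smul, smul_smul, inv_mul_cancel₀ hs']
    · simpa [HasCurveDerivAt] using tendsto_const_nhds

theorem IsSmoothCurve.add [IsTopologicalAddGroup V] {c d : ℝ → V} (hc : IsSmoothCurve c)
    (hd : IsSmoothCurve d) : IsSmoothCurve (c + d) := by
  obtain ⟨C, rfl, hC⟩ := hc
  obtain ⟨D, rfl, hD⟩ := hd
  refine ⟨fun n => C n + D n, rfl, fun n => ⟨(hC n).1.add (hD n).1, fun t => ?_⟩⟩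
  refine (((hC n).2 t).add ((hD n).2 t)).congr fun s => ?_
  simp only [Pi.add_apply, ← smul_add]
  congr 1
  abel

theorem IsSmoothCurve.smul [ContinuousSMul ℝ V] {c : ℝ → V} (r : ℝ)
    (hc : IsSmoothCurve c) : IsSmoothCurve (r • c) := by
  obtain ⟨C, rfl, hC⟩ := hc
  refine ⟨fun n => r • C n, rfl, fun n => ⟨(hC n).1.const_smul r, fun t => ?_⟩⟩
  refine (((hC n).2 t).const_smul r).congr fun s => ?_
  simp only [Pi.smul_apply, ← smul_sub, smul_comm r]

theorem IsSmoothCurve.prodMk {c : ℝ → V} {d : ℝ → W} (hc : IsSmoothCurve c)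
    (hd : IsSmoothCurve d) : IsSmoothCurve (fun t => (c t, d t)) := by
  obtain ⟨C, rfl, hC⟩ := hc
  obtain ⟨D, rfl, hD⟩ := hd
  exact ⟨fun n t => (C n t, D n t), rfl, fun n => ⟨(hC n).1.prodMk (hD n).1,
    fun t => ((hC n).2 t).prodMk_nhds ((hD n).2 t)⟩⟩

theorem isSmoothMap_const (w : W) : IsSmoothMap (fun _ : V => w) :=
  fun _ _ => isSmoothCurve_const w

theorem IsSmoothMap.add [IsTopologicalAddGroup W] {f g : V → W} (hf : IsSmoothMap f)
    (hg : IsSmoothMap g) : IsSmoothMap (f + g) :=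
  fun c hc => (hf c hc).add (hg c hc)

theorem IsSmoothMap.smul [ContinuousSMul ℝ W] {f : V → W} (r : ℝ) (hf : IsSmoothMap f) :
    IsSmoothMap (r • f) :=
  fun c hc => (hf c hc).smul r

theorem dirDeriv_eq [T2Space W] {f : V → W} {x v : V} {w : W}
    (h : HasCurveDerivAt (fun t : ℝ => f (x + t • v)) w 0) : dirDeriv f x v = w := by
  refine Tendsto.limUnder_eq ?_
  simpa [HasCurveDerivAt] using h

theorem hasCurveDerivAt_dirDeriv [T2Space W] {f : V → W} {x v : V}
    (h : ∃ w, HasCurveDerivAt (fun t : ℝ => f (x + t • v)) w 0) :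
    HasCurveDerivAt (fun t : ℝ => f (x + t • v)) (dirDeriv f x v) 0 := by
  obtain ⟨w, hw⟩ := h
  rwa [dirDeriv_eq hw]

theorem IsSmoothMap.exists_dirDeriv [IsTopologicalAddGroup V] [ContinuousSMul ℝ V]
    {f : V → W} (hf : IsSmoothMap f) (x v : V) :
    ∃ w, HasCurveDerivAt (fun t : ℝ => f (x + t • v)) w 0 :=
  (hf _ (isSmoothCurve_line x v)).exists_deriv 0

theorem dirDeriv_add_of [T2Space W] [IsTopologicalAddGroup W] {f g : V → W} {x v : V}
    (hf : ∃ w, HasCurveDerivAt (fun t : ℝ => f (x + t • v)) w 0)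
    (hg : ∃ w, HasCurveDerivAt (fun t : ℝ => g (x + t • v)) w 0) :
    dirDeriv (f + g) x v = dirDeriv f x v + dirDeriv g x v := by
  refine dirDeriv_eq ?_
  refine ((hasCurveDerivAt_dirDeriv hf).add (hasCurveDerivAt_dirDeriv hg)).congr fun s => ?_
  simp only [Pi.add_apply, ← smul_add]
  congr 1
  abel

theorem dirDeriv_smul_of [T2Space W] [ContinuousSMul ℝ W] {f : V → W} {x v : V} (r : ℝ)
    (hf : ∃ w, HasCurveDerivAt (fun t : ℝ => f (x + t • v)) w 0) :
    dirDeriv (r • f) x v = r • dirDeriv f x v := by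
  refine dirDeriv_eq ?_
  refine ((hasCurveDerivAt_dirDeriv hf).const_smul r).congr fun s => ?_
  simp only [Pi.smul_apply, ← smul_sub, smul_comm r]

theorem dirDeriv_const [T2Space W] (w : W) (x v : V) : dirDeriv (fun _ : V => w) x v = 0 := by
  refine dirDeriv_eq ?_
  simp [HasCurveDerivAt]

theorem IsSmoothMap.dirDeriv_add [T2Space W] [IsTopologicalAddGroup W]
    [IsTopologicalAddGroup V] [ContinuousSMul ℝ V] {f g : V → W}
    (hf : IsSmoothMap f) (hg : IsSmoothMap g) (x v : V) :
    dirDeriv (f + g) x v = dirDeriv f x v + dirDeriv g x v :=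
  dirDeriv_add_of (hf.exists_dirDeriv x v) (hg.exists_dirDeriv x v)

theorem IsSmoothMap.dirDeriv_smul [T2Space W] [ContinuousSMul ℝ W]
    [IsTopologicalAddGroup V] [ContinuousSMul ℝ V] {f : V → W} (r : ℝ)
    (hf : IsSmoothMap f) (x v : V) :
    dirDeriv (r • f) x v = r • dirDeriv f x v :=
  dirDeriv_smul_of r (hf.exists_dirDeriv x v)

theorem iterDeriv_zero (n : ℕ) (x : V) (y : Fin n → V) :
    iterDeriv (0 : V → ℝ) n x y = 0 := by
  induction n generalizing x with
  | zero => rfl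
  | succ n ih =>
    simp only [iterDeriv, ih]
    exact dirDeriv_const 0 x _

end Calculus

/-! ## Differential forms, de Rham cohomology in degrees `0` and `1` -/

section DeRham

variable (V : Type*) [AddCommGroup V] [Module ℝ V] [TopologicalSpace V]

/-- `C^∞(V, ℝ)`. -/
def smoothFunctions : Submodule ℝ (V → ℝ) where
  carrier := {f | IsSmoothMap f}
  zero_mem' := isSmoothMap_const 0
  add_mem' := fun hf hg => hf.add hg
  smul_mem' := fun r _ hf => hf.smul r

/-- The maps `V → V' = L(V, ℝ)` into the topological dual, i.e. the `1`-forms on `V` without any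
smoothness requirement. -/
def RawOneForm : Type _ := V → V →L[ℝ] ℝ

instance : AddCommGroup (RawOneForm V) := inferInstanceAs (AddCommGroup (V → V →L[ℝ] ℝ))

instance : Module ℝ (RawOneForm V) := inferInstanceAs (Module ℝ (V → V →L[ℝ] ℝ))

/-- `Ω¹(V)`: the smooth `1`-forms, i.e. the maps `α : V → V' = L(V, ℝ)` for which
`(x, v) ↦ α(x)v` is smooth. -/
def oneForms : Submodule ℝ (RawOneForm V) where
  carrier := {α | IsSmoothMap fun p : V × V => α p.1 p.2}
  zero_mem' := isSmoothMap_const 0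
  add_mem' := fun hf hg => IsSmoothMap.add hf hg
  smul_mem' := fun r _ hf => IsSmoothMap.smul r hf

variable {V}

/-- The exterior derivative of a `1`-form, `(dα)(x)(u, v)`. -/
def extDeriv (α : RawOneForm V) (x u v : V) : ℝ :=
  dirDeriv (fun x' => α x' v) x u - dirDeriv (fun x' => α x' u) x v

/-- The Lie derivative `(L_ξ β)(x)(u, v)` of a `2`-form `β` along the vector field `ξ`. -/
def lieDeriv (ξ : V → V) (β : V → V →ₗ[ℝ] V →L[ℝ] ℝ) (x u v : V) : ℝ :=
  dirDeriv (fun x' => β x' u v) x (ξ x) + β x (dirDeriv ξ x u) v + β x u (dirDeriv ξ x v)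

theorem isSmoothMap_oneForm_apply {α : RawOneForm V} (hα : α ∈ oneForms V) (v : V) :
    IsSmoothMap fun x => α x v :=
  fun c hc => hα (fun t => (c t, v)) (hc.prodMk (isSmoothCurve_const v))

variable (V) [IsTopologicalAddGroup V] [ContinuousSMul ℝ V]

/-- `H⁰(V)`: the closed `0`-forms, i.e. the smooth functions `f` with `df = 0`. -/
def H0 : Submodule ℝ (V → ℝ) where
  carrier := {f | IsSmoothMap f ∧ ∀ x v, dirDeriv f x v = 0}
  zero_mem' := ⟨isSmoothMap_const 0, fun x v => dirDeriv_const 0 x v⟩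
  add_mem' := fun hf hg => ⟨hf.1.add hg.1, fun x v => by
    rw [hf.1.dirDeriv_add hg.1, hf.2, hg.2, add_zero]⟩
  smul_mem' := fun r _ hf => ⟨hf.1.smul r, fun x v => by
    rw [hf.1.dirDeriv_smul r, hf.2, smul_zero]⟩

/-- The closed `1`-forms. -/
def closedOneForms : Submodule ℝ (RawOneForm V) where
  carrier := {α | α ∈ oneForms V ∧ ∀ x u v, extDeriv α x u v = 0}
  zero_mem' := ⟨zero_mem _, fun x u v => by
    have h : ∀ u v, dirDeriv (fun x' => (0 : RawOneForm V) x' v) x u = 0 := fun u v =>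
      dirDeriv_const (0 : ℝ) x u
    rw [extDeriv, h, h, sub_zero]⟩
  add_mem' := by
    rintro α β ⟨hα, hα'⟩ ⟨hβ, hβ'⟩
    refine ⟨add_mem hα hβ, fun x u v => ?_⟩
    have h : ∀ u v, dirDeriv (fun x' => (α + β) x' v) x u
        = dirDeriv (fun x' => α x' v) x u + dirDeriv (fun x' => β x' v) x u := fun u v =>
      (isSmoothMap_oneForm_apply hα v).dirDeriv_add (isSmoothMap_oneForm_apply hβ v) x u
    have h1 := hα' x u v
    have h2 := hβ' x u v
    simp only [extDeriv] at h1 h2 ⊢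
    rw [h, h]
    linarith
  smul_mem' := by
    rintro r α ⟨hα, hα'⟩
    refine ⟨Submodule.smul_mem _ r hα, fun x u v => ?_⟩
    have h : ∀ u v, dirDeriv (fun x' => (r • α) x' v) x u
        = r • dirDeriv (fun x' => α x' v) x u := fun u v =>
      (isSmoothMap_oneForm_apply hα v).dirDeriv_smul r x u
    have h1 := hα' x u v
    simp only [extDeriv] at h1 ⊢
    rw [h, h, ← smul_sub, h1, smul_zero]

/-- The exact `1`-forms: the smooth `1`-forms `df` with `f` a smooth function. -/
def exactOneForms : Submodule ℝ (RawOneForm V) where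
  carrier := {α | α ∈ oneForms V ∧ ∃ f ∈ smoothFunctions V, ∀ x v, α x v = dirDeriv f x v}
  zero_mem' := ⟨zero_mem _, 0, zero_mem _, fun x v => (dirDeriv_const (0 : ℝ) x v).symm⟩
  add_mem' := by
    rintro α β ⟨hα, f, hf, hαf⟩ ⟨hβ, g, hg, hβg⟩
    refine ⟨add_mem hα hβ, f + g, add_mem hf hg, fun x v => ?_⟩
    rw [IsSmoothMap.dirDeriv_add hf hg, ← hαf, ← hβg]
    rfl
  smul_mem' := by
    rintro r α ⟨hα, f, hf, hαf⟩
    refine ⟨Submodule.smul_mem _ r hα, r • f, Submodule.smul_mem _ r hf, fun x v => ?_⟩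
    rw [IsSmoothMap.dirDeriv_smul r hf, ← hαf]
    rfl

/-- The first de Rham cohomology `H¹(V)`: closed `1`-forms modulo exact `1`-forms. -/
abbrev H1 : Type _ := closedOneForms V ⧸ (exactOneForms V).submoduleOf (closedOneForms V)

end DeRham

/-! ## Weak symplectic vector spaces -/

section Symplectic

set_option linter.unusedSectionVars false

/-- A (constant) weak symplectic form, given as the mapping `ω̌ : V → V' = L(V, ℝ)`, which is
alternating and injective, but not necessarily surjective. -/
structure WeakSymplecticForm (V : Type*) [AddCommGroup V] [Module ℝ V] [TopologicalSpace V] where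
  /-- The mapping `x ↦ ω(x, ·)`. -/
  form : V →ₗ[ℝ] V →L[ℝ] ℝ
  self_eq_zero : ∀ x, form x x = 0
  injective : Function.Injective form

variable {V : Type*} [AddCommGroup V] [Module ℝ V] [TopologicalSpace V]

theorem WeakSymplecticForm.skew (ω : WeakSymplecticForm V) (x y : V) :
    ω.form x y = -ω.form y x := by
  have h := ω.self_eq_zero (x + y)
  simp only [map_add, add_apply, ω.self_eq_zero] at h
  linarith

variable [IsTopologicalAddGroup V] [ContinuousSMul ℝ V]

/-- Along the values of a smooth representing map `Z`, all directional derivatives of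
`ω(Z(·), y)` exist. -/
theorem WeakSymplecticForm.exists_deriv (ω : WeakSymplecticForm V) {c : ℝ → V}
    (hc : IsSmoothCurve c) (y : V) : ∃ w, HasCurveDerivAt (fun t => ω.form (c t) y) w 0 := by
  obtain ⟨v, hv⟩ := hc.exists_deriv 0
  refine ⟨-ω.form y v, ?_⟩
  refine ((((ω.form y).continuous.tendsto v).comp hv).neg).congr fun s => ?_
  simp only [Function.comp, map_smul, map_sub, ω.skew _ y, smul_eq_mul]
  ring

/-- The condition on the `(n+1)`-st derivative of `f` in the definition of `C^∞_*(V, ℝ)`: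
`dⁿ⁺¹f(x)(·, y₂, …, yₙ₊₁)` lies in the smooth dual `ω(V, ·)` for all `x, y₂, …, yₙ₊₁`, and the
mapping `(x, y₂, …, yₙ₊₁) ↦ Z(x, y₂, …, yₙ₊₁) = ω̌⁻¹(dⁿ⁺¹f(x)(·, y₂, …, yₙ₊₁))` is smooth. -/
def HasSmoothDualDeriv (ω : WeakSymplecticForm V) (f : V → ℝ) (n : ℕ) : Prop :=
  ∃ Z : V × (Fin n → V) → V, IsSmoothMap Z ∧
    ∀ (x : V) (y : Fin n → V) (y₁ : V),
      iterDeriv f (n + 1) x (Fin.cons y₁ y) = ω.form (Z (x, y)) y₁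

theorem exists_deriv_iterDeriv (ω : WeakSymplecticForm V) {f : V → ℝ} (hf : IsSmoothMap f)
    (hZ : ∀ n, HasSmoothDualDeriv ω f n) (n : ℕ) (x v : V) (y : Fin n → V) :
    ∃ w, HasCurveDerivAt (fun t : ℝ => iterDeriv f n (x + t • v) y) w 0 := by
  rcases n with _ | n
  · exact hf.exists_dirDeriv x v
  · obtain ⟨Z, hZs, hZf⟩ := hZ n
    have hc : IsSmoothCurve fun t : ℝ => Z (x + t • v, Fin.tail y) :=
      hZs _ ((isSmoothCurve_line x v).prodMk (isSmoothCurve_const _))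
    obtain ⟨w, hw⟩ := ω.exists_deriv hc (y 0)
    refine ⟨w, hw.congr fun s => ?_⟩
    simp only [← hZf, Fin.cons_self_tail]

theorem iterDeriv_add (ω : WeakSymplecticForm V) {f g : V → ℝ} (hf : IsSmoothMap f)
    (hg : IsSmoothMap g) (hZ : ∀ n, HasSmoothDualDeriv ω f n)
    (hY : ∀ n, HasSmoothDualDeriv ω g n) (n : ℕ) (x : V) (y : Fin n → V) :
    iterDeriv (f + g) n x y = iterDeriv f n x y + iterDeriv g n x y := by
  induction n generalizing x with
  | zero => rfl
  | succ n ih =>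
    simp only [iterDeriv, ih]
    exact dirDeriv_add_of (exists_deriv_iterDeriv ω hf hZ n x _ _)
      (exists_deriv_iterDeriv ω hg hY n x _ _)

theorem iterDeriv_smul (ω : WeakSymplecticForm V) {f : V → ℝ} (r : ℝ) (hf : IsSmoothMap f)
    (hZ : ∀ n, HasSmoothDualDeriv ω f n) (n : ℕ) (x : V) (y : Fin n → V) :
    iterDeriv (r • f) n x y = r • iterDeriv f n x y := by
  induction n generalizing x with
  | zero => rfl
  | succ n ih =>
    simp only [iterDeriv, ih]
    exact dirDeriv_smul_of r (exists_deriv_iterDeriv ω hf hZ n x _ _)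

/-- `C^∞_*(V, ℝ)`: the smooth functions all of whose derivatives `dᵏf`, `k ≥ 1`, take values in
the smooth dual, smoothly. -/
def smoothStar (ω : WeakSymplecticForm V) : Submodule ℝ (V → ℝ) where
  carrier := {f | IsSmoothMap f ∧ ∀ n, HasSmoothDualDeriv ω f n}
  zero_mem' := ⟨isSmoothMap_const 0, fun n => ⟨fun _ => 0, isSmoothMap_const 0, fun x y y₁ => by
    rw [iterDeriv_zero]; simp⟩⟩
  add_mem' := by
    rintro f g ⟨hf, hZ⟩ ⟨hg, hY⟩
    refine ⟨hf.add hg, fun n => ?_⟩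
    obtain ⟨Z, hZs, hZf⟩ := hZ n
    obtain ⟨Y, hYs, hYg⟩ := hY n
    refine ⟨Z + Y, hZs.add hYs, fun x y y₁ => ?_⟩
    rw [iterDeriv_add ω hf hg hZ hY, hZf, hYg]
    simp
  smul_mem' := by
    rintro r f ⟨hf, hZ⟩
    refine ⟨hf.smul r, fun n => ?_⟩
    obtain ⟨Z, hZs, hZf⟩ := hZ n
    refine ⟨r • Z, hZs.smul r, fun x y y₁ => ?_⟩
    rw [iterDeriv_smul ω r hf hZ, hZf]
    simp

/-- `𝔛_ω(V)`: the smooth vector fields `ξ` with `L_ξ ω = 0`. -/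
def symplecticFields [T2Space V] (ω : WeakSymplecticForm V) : Submodule ℝ (V → V) where
  carrier := {ξ | IsSmoothMap ξ ∧ ∀ x u v, lieDeriv ξ (fun _ => ω.form) x u v = 0}
  zero_mem' := ⟨isSmoothMap_const 0, fun x u v => by
    have h : ∀ u, dirDeriv (0 : V → V) x u = 0 := fun u => dirDeriv_const 0 x u
    simp [lieDeriv, dirDeriv_const, h]⟩
  add_mem' := by
    rintro ξ η ⟨hξ, hξ'⟩ ⟨hη, hη'⟩
    refine ⟨hξ.add hη, fun x u v => ?_⟩
    have h1 := hξ' x u v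
    have h2 := hη' x u v
    simp only [lieDeriv, dirDeriv_const, hξ.dirDeriv_add hη, map_add,
      add_apply] at h1 h2 ⊢
    linarith
  smul_mem' := by
    rintro r ξ ⟨hξ, hξ'⟩
    refine ⟨hξ.smul r, fun x u v => ?_⟩
    have h1 := hξ' x u v
    simp only [lieDeriv, dirDeriv_const, hξ.dirDeriv_smul r, map_smul, zero_add,
      smul_apply, smul_eq_mul] at h1 ⊢
    rw [← mul_add, h1, mul_zero]

end Symplectic

/-! ## Lie brackets on a given real vector space -/

section Lie

variable {L M : Type*} [AddCommGroup L] [Module ℝ L] [AddCommGroup M] [Module ℝ M]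

/-- The bilinear map `b` is a Lie algebra structure on the real vector space `L`. -/
def IsLieBracket (b : L →ₗ[ℝ] L →ₗ[ℝ] L) : Prop :=
  (∀ x, b x x = 0) ∧ ∀ x y z, b x (b y z) + b y (b z x) + b z (b x y) = 0

/-- The linear map `φ` is a homomorphism from the Lie algebra `(L, b)` to the Lie algebra
`(M, b')`. -/
def IsLieHom (b : L →ₗ[ℝ] L →ₗ[ℝ] L) (b' : M →ₗ[ℝ] M →ₗ[ℝ] M) (φ : L →ₗ[ℝ] M) : Prop :=
  ∀ x y, φ (b x y) = b' (φ x) (φ y)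

end Lie

/-! ## The compact `C^∞`-topology -/

open scoped ContDiff

section CompactOpen

variable (E : Type*) [NormedAddCommGroup E] [NormedSpace ℝ E]
  (G : Type*) [TopologicalSpace G] [ChartedSpace E G]
  (F : Type*) [NormedAddCommGroup F] [NormedSpace ℝ F]

/-- The indices of the seminorms that define the compact `C^∞`-topology: a chart `φ`, a compact
subset `K` of the range of `φ`, and an order of differentiation. -/
abbrev SeminormIndex : Type _ :=
  (Σ φ : atlas E G, {K : Set E // IsCompact K ∧ K ⊆ φ.1.target}) × ℕ

variable {E G F}

theorem contDiffAt_chart_symm [IsManifold 𝓘(ℝ, E) ∞ G]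
    (f : C^∞⟮𝓘(ℝ, E), G; 𝓘(ℝ, F), F⟯) (i : SeminormIndex E G) {y : E} (hy : y ∈ i.1.2.1) :
    ContDiffAt ℝ ∞ (f ∘ i.1.1.1.symm) y := by
  have hy' := i.1.2.2.2 hy
  have h1 : ContMDiffOn 𝓘(ℝ, E) 𝓘(ℝ, E) ∞ i.1.1.1.symm i.1.1.1.target :=
    contMDiffOn_symm_of_mem_maximalAtlas (IsManifold.subset_maximalAtlas i.1.1.2)
  have h2 : ContMDiffOn 𝓘(ℝ, E) 𝓘(ℝ, F) ∞ (f ∘ i.1.1.1.symm) i.1.1.1.target :=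
    f.contMDiff.comp_contMDiffOn h1
  exact h2.contDiffOn.contDiffAt (i.1.1.1.open_target.mem_nhds hy')

theorem bddAbove_iteratedFDeriv [IsManifold 𝓘(ℝ, E) ∞ G]
    (f : C^∞⟮𝓘(ℝ, E), G; 𝓘(ℝ, F), F⟯) (i : SeminormIndex E G) :
    BddAbove (Set.range fun y : i.1.2.1 =>
      ‖iteratedFDeriv ℝ i.2 (f ∘ i.1.1.1.symm) y‖) := by
  have hc : ContinuousOn (fun y => ‖iteratedFDeriv ℝ i.2 (f ∘ i.1.1.1.symm) y‖) i.1.2.1 := by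
    intro y hy
    have h := contDiffAt_chart_symm f i hy
    exact ((h.iteratedFDeriv_right (m := 0) (i := i.2)
      (by simpa using by exact_mod_cast le_top)).continuousAt.norm).continuousWithinAt
  have := (i.1.2.2.1.image_of_continuousOn hc).bddAbove
  rwa [Set.image_eq_range] at this

/-- The seminorm `f ↦ sup_{y ∈ K} ‖Dᵏ(f ∘ φ⁻¹)(y)‖`. -/
def cInftySeminorm [IsManifold 𝓘(ℝ, E) ∞ G] (i : SeminormIndex E G) :
    Seminorm ℝ C^∞⟮𝓘(ℝ, E), G; 𝓘(ℝ, F), F⟯ :=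
  Seminorm.of (fun f => ⨆ y : i.1.2.1, ‖iteratedFDeriv ℝ i.2 (f ∘ i.1.1.1.symm) y‖)
    (by
      intro f g
      refine Real.iSup_le (fun y => ?_) (add_nonneg (Real.iSup_nonneg fun _ => norm_nonneg _)
        (Real.iSup_nonneg fun _ => norm_nonneg _))
      have hle : ((i.2 : ℕ) : WithTop ℕ∞) ≤ ∞ := by exact_mod_cast le_top
      have h : iteratedFDeriv ℝ i.2 (⇑(f + g) ∘ i.1.1.1.symm) y
          = iteratedFDeriv ℝ i.2 (f ∘ i.1.1.1.symm) y
            + iteratedFDeriv ℝ i.2 (g ∘ i.1.1.1.symm) y :=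
        iteratedFDeriv_add_apply ((contDiffAt_chart_symm f i y.2).of_le hle)
          ((contDiffAt_chart_symm g i y.2).of_le hle)
      rw [h]
      exact (norm_add_le _ _).trans (add_le_add (le_ciSup (bddAbove_iteratedFDeriv f i) y)
        (le_ciSup (bddAbove_iteratedFDeriv g i) y)))
    (by
      intro r f
      have hle : ((i.2 : ℕ) : WithTop ℕ∞) ≤ ∞ := by exact_mod_cast le_top
      rw [Real.mul_iSup_of_nonneg (norm_nonneg r)]
      congr 1
      ext y
      have h : iteratedFDeriv ℝ i.2 (⇑(r • f) ∘ i.1.1.1.symm) y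
          = r • iteratedFDeriv ℝ i.2 (f ∘ i.1.1.1.symm) y :=
        iteratedFDeriv_const_smul_apply ((contDiffAt_chart_symm f i y.2).of_le hle)
      rw [h, norm_smul])

variable (E G F) in
/-- The seminorms that define the compact `C^∞`-topology. -/
def cInftySeminormFamily [IsManifold 𝓘(ℝ, E) ∞ G] :
    SeminormFamily ℝ C^∞⟮𝓘(ℝ, E), G; 𝓘(ℝ, F), F⟯ (SeminormIndex E G) :=
  fun i => cInftySeminorm i

variable (E G F) in
/-- The compact `C^∞`-topology on `C^∞(G, F)`: uniform convergence on compact sets, in all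
derivatives separately. -/
@[reducible] def compactCInftyTopology [IsManifold 𝓘(ℝ, E) ∞ G] :
    TopologicalSpace C^∞⟮𝓘(ℝ, E), G; 𝓘(ℝ, F), F⟯ :=
  (cInftySeminormFamily E G F).moduleFilterBasis.topology

end CompactOpen

/-! ## The space of smooth vectors of a unitary representation -/

section SmoothVectors

variable (E : Type*) [NormedAddCommGroup E] [NormedSpace ℝ E]
  {G : Type*} [Group G] [TopologicalSpace G] [ChartedSpace E G]
  {H : Type*} [NormedAddCommGroup H] [InnerProductSpace ℂ H] [CompleteSpace H]

/-- The complex linear subspace of all `x` for which `g ↦ ρ(g)x`, `G → H`, is smooth. -/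
def smoothVectorSubspace (ρ : G →* unitary (H →L[ℂ] H)) : Submodule ℂ H where
  carrier := {x | ContMDiff 𝓘(ℝ, E) 𝓘(ℝ, H) ∞ fun g => (ρ g : H →L[ℂ] H) x}
  zero_mem' := by simpa using contMDiff_const
  add_mem' := by
    intro x y hx hy
    have h : ContMDiff 𝓘(ℝ, E) 𝓘(ℝ, H) ∞
      fun g => (ρ g : H →L[ℂ] H) x + (ρ g : H →L[ℂ] H) y := ContMDiff.add hx hy
    simpa using h
  smul_mem' := by
    intro a x hx
    have h : ContMDiff 𝓘(ℝ, E) 𝓘(ℝ, H) ∞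
      fun g => (a • ContinuousLinearMap.id ℝ H) ((ρ g : H →L[ℂ] H) x) :=
      (a • ContinuousLinearMap.id ℝ H).contDiff.contMDiff.comp hx
    simpa using h

/-- `H_∞`, the space of smooth vectors. (A type of its own, because it does not carry the
topology of a subspace of `H`. It is a complex vector space, and hence a real one.) -/
def SmoothVectors (ρ : G →* unitary (H →L[ℂ] H)) : Type _ := smoothVectorSubspace E ρ

namespace SmoothVectors

variable {E} (ρ : G →* unitary (H →L[ℂ] H))

instance : AddCommGroup (SmoothVectors E ρ) :=
  inferInstanceAs (AddCommGroup (smoothVectorSubspace E ρ))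

instance : Module ℂ (SmoothVectors E ρ) :=
  inferInstanceAs (Module ℂ (smoothVectorSubspace E ρ))

/-- The inclusion `H_∞ → H`. -/
def incl : SmoothVectors E ρ →ₗ[ℝ] H where
  toFun x := x.1
  map_add' _ _ := rfl
  map_smul' _ _ := rfl

theorem incl_injective : Function.Injective (incl (E := E) ρ) := Subtype.val_injective

/-- The embedding `j : H_∞ → C^∞(G, H)`, `j(x)(g) = ρ(g)x`. -/
def orbitMap : SmoothVectors E ρ →ₗ[ℝ] C^∞⟮𝓘(ℝ, E), G; 𝓘(ℝ, H), H⟯ where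
  toFun x := ⟨fun g => (ρ g : H →L[ℂ] H) (incl ρ x), x.2⟩
  map_add' x y := by
    ext g
    exact map_add (ρ g : H →L[ℂ] H) _ _
  map_smul' r x := by
    ext g
    exact ((ρ g : H →L[ℂ] H).restrictScalars ℝ).map_smul r (incl ρ x)

variable [IsManifold 𝓘(ℝ, E) ∞ G]

/-- The topology of `H_∞`, induced by the compact `C^∞`-topology through `j`. -/
instance : TopologicalSpace (SmoothVectors E ρ) :=
  (compactCInftyTopology E G H).induced (orbitMap ρ)

theorem withSeminorms :
    WithSeminorms ((cInftySeminormFamily E G H).comp (orbitMap ρ)) := by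
  let _ := compactCInftyTopology E G H
  have h : WithSeminorms (cInftySeminormFamily E G H) := ⟨rfl⟩
  have := h.topologicalAddGroup
  exact LinearMap.withSeminorms_induced h (orbitMap ρ)

instance : IsTopologicalAddGroup (SmoothVectors E ρ) := (withSeminorms ρ).topologicalAddGroup

instance : ContinuousSMul ℝ (SmoothVectors E ρ) := (withSeminorms ρ).continuousSMul

/-- The index of the seminorm `x ↦ ‖ρ(1)x‖ = ‖x‖`. -/
def normIndex (E : Type*) [NormedAddCommGroup E] [NormedSpace ℝ E]
    (G : Type*) [Group G] [TopologicalSpace G] [ChartedSpace E G] : SeminormIndex E G :=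
  ⟨⟨⟨chartAt E (1 : G), chart_mem_atlas E (1 : G)⟩, {chartAt E (1 : G) 1}, isCompact_singleton,
    Set.singleton_subset_iff.2 (mem_chart_target E (1 : G))⟩, 0⟩

theorem seminorm_normIndex (x : SmoothVectors E ρ) :
    (cInftySeminormFamily E G H).comp (orbitMap ρ) (normIndex E G) x = ‖incl ρ x‖ := by
  change (⨆ y : ({chartAt E (1 : G) 1} : Set E),
    ‖iteratedFDeriv ℝ 0 (orbitMap ρ x ∘ (chartAt E (1 : G)).symm) y‖) = _
  rw [ciSup_unique]
  simp only [norm_iteratedFDeriv_zero, Function.comp]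
  change ‖(ρ ((chartAt E (1 : G)).symm (chartAt E (1 : G) 1)) : H →L[ℂ] H) (incl ρ x)‖ = _
  rw [(chartAt E (1 : G)).left_inv (mem_chart_source E (1 : G))]
  simp

theorem continuous_incl : Continuous (incl (E := E) ρ) := by
  refine (withSeminorms ρ).continuous_normedSpace_rng H (incl ρ)
    ⟨{normIndex E G}, 1, fun x => ?_⟩
  simp [seminorm_normIndex]

instance : T2Space (SmoothVectors E ρ) :=
  T2Space.of_injective_continuous (incl_injective ρ) (continuous_incl ρ)

/-- The weak symplectic form `ω = Im ⟨·, ·⟩` on `H_∞`, where the Hermitian inner product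
`⟨x, y⟩` is complex linear in `x` and conjugate linear in `y`. -/
def symplecticForm : WeakSymplecticForm (SmoothVectors E ρ) where
  form :=
    { toFun := fun x =>
        { toFun := fun y => (inner ℂ (incl ρ y) (incl ρ x)).im
          map_add' := fun y z => by simp
          map_smul' := fun r y => by simp
          cont := by
            have h := continuous_incl (E := E) ρ
            fun_prop }
      map_add' := fun x y => by
        ext z
        simp
      map_smul' := fun r x => by
        ext z
        simp }
  self_eq_zero := fun x => by
    change (inner ℂ (incl ρ x) (incl ρ x)).im = 0
    exact inner_self_im (𝕜 := ℂ) (incl ρ x)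
  injective := by
    refine (injective_iff_map_eq_zero _).2 fun x hx => ?_
    have h : (inner ℂ (Complex.I • incl ρ x) (incl ρ x)).im = 0 :=
      DFunLike.congr_fun hx (Complex.I • x)
    rw [inner_smul_left, inner_self_eq_norm_sq_to_K] at h
    refine incl_injective ρ ?_
    rw [map_zero, ← norm_eq_zero]
    simpa [← Complex.ofReal_pow] using h

@[simp]
theorem symplecticForm_apply (x y : SmoothVectors E ρ) :
    (symplecticForm ρ).form x y = (inner ℂ (incl ρ y) (incl ρ x)).im := rfl

end SmoothVectors

end SmoothVectors

end UnitaryMoment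

end

open UnitaryMoment
open scoped Manifold ContDiff

open Filter Topology MeasureTheory
open scoped FourierTransform RealInnerProductSpace

/-! ## Functions with bounded iterated derivatives along the lines of a basis -/

/-! The geometric half is formal and works on any Hausdorff topological vector space `V` with a
jointly continuous weak symplectic form `ω`, provided that directional derivatives of smooth
mappings into `V` are again smooth (`HasSmoothPartialDerivs`). By Schwarz's theorem `dⁿ⁺¹f(x)(v, y)
= dⁿ(df(·)v)(x)(y)`, so if `df = ω(ξ, ·)` with `ξ` smooth, then `dⁿ⁺¹f(x)(·, y) = ω(dⁿξ(x)(y), ·)`.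
Hence membership in `C^∞_*` is a condition on the first derivative alone (`mem_smoothStar_iff`).
Since `ω` is constant, `L_ξ ω = 0` says that `ω(dξ(x)u, v)` is symmetric in `u` and `v`, that is,
`i_ξ ω` is closed. The radial Poincaré lemma gives it a primitive, so `grad` is surjective onto the
symplectic fields and `H¹ = 0`. The same symmetry shows that `ω(η, ξ)` is a Hamiltonian of `[ξ, η]`.
This makes `grad` a homomorphism, reduces the Jacobi identity of the Poisson bracket to cancellation
in pairs, and transfers it to vector fields through `grad`.

The analytic half shows that `H_∞` has the required property. The key is an exponential law: a curve
`c` in `H_∞` is smooth if and only if `(t, g) ↦ ρ(g)c(t)` is smooth into `H`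
(`IsSmoothCurve.isJointlySmooth`, `IsJointlySmooth.isSmoothCurve`). For the direct implication, the
derivatives in `t` alone are bounded because `ρ(g)` is isometric, those in `g` alone by the
seminorms of `H_∞`, and a function whose pure derivatives along a basis are locally bounded is
smooth (`contDiffOn_of_locally_bounded_lineDeriv`). That criterion comes from the decay of Fourier
transforms; it also yields Boman's theorem (`contDiffOn_of_comp_curve`), which turns smoothness
along curves into smoothness of mappings from finite dimensional spaces to `H`. -/

theorem fourier_hasLineDerivAt {X F : Type*} [NormedAddCommGroup X] [InnerProductSpace ℝ X]
    [FiniteDimensional ℝ X] [MeasurableSpace X] [BorelSpace X]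
    [NormedAddCommGroup F] [NormedSpace ℂ F] {f f' : X → F} {v : X}
    (hf : Integrable f) (hf' : Integrable f') (h : ∀ x, HasLineDerivAt ℝ f (f' x) x v) (w : X) :
    𝓕 f' w = (2 * Real.pi * Complex.I * (⟪v, w⟫ : ℝ)) • 𝓕 f w := by
  -- Integration by parts in the single direction `v` against the character, whose derivative along
  -- `v` is a scalar multiple of itself.
  have key := integral_bilinear_hasLineDerivAt_right_eq_neg_left_of_integrable (μ := volume)
    (B := ContinuousLinearMap.lsmul ℝ ℂ)
    (f := fun x : X => (Real.fourierChar (-(innerSL ℝ x w)) : ℂ))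
    (f' := fun x : X => -(2 * Real.pi * Complex.I * (⟪v, w⟫ : ℝ)) *
      (Real.fourierChar (-(innerSL ℝ x w)) : ℂ)) (g := f) (g' := f') (v := v) ?_ ?_ ?_ ?_ ?_
  · simp only [ContinuousLinearMap.lsmul_apply, mul_smul, neg_smul, integral_neg, neg_neg,
      integral_smul] at key
    simpa only [Real.fourier_eq, Circle.smul_def, innerSL_apply_apply, mul_smul,
      integral_smul] using key
  · have := Integrable.smul (-(2 * Real.pi * Complex.I * (⟪v, w⟫ : ℝ)))
      ((Real.fourierIntegral_convergent_iff (V := X) w).2 hf)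
    simp only [ContinuousLinearMap.lsmul_apply, mul_smul, innerSL_apply_apply]
    exact this
  · simpa only [ContinuousLinearMap.lsmul_apply, Circle.smul_def, innerSL_apply_apply] using
      (Real.fourierIntegral_convergent_iff (V := X) w).2 hf'
  · simpa only [ContinuousLinearMap.lsmul_apply, Circle.smul_def, innerSL_apply_apply] using
      (Real.fourierIntegral_convergent_iff (V := X) w).2 hf
  · intro x _
    have : HasLineDerivAt ℝ (fun x : X => (Real.fourierChar (-⟪x, w⟫) : ℂ))
        (-2 * Real.pi * Complex.I * Real.fourierChar (-⟪x, w⟫) * (⟪v, w⟫ : ℝ)) x v :=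
      (Real.hasFDerivAt_fourierChar_neg_bilinear_left (innerSL ℝ) x w).hasLineDerivAt v
    simp only [innerSL_apply_apply]
    convert this using 1
    ring
  · intro x _
    exact h x

/-- Rapid decay makes all moments of `𝓕 f` integrable, so Fourier inversion applies and the
inversion integral may be differentiated under the integral sign to any order. -/
theorem contDiff_of_fourier_decay {X F : Type*} [NormedAddCommGroup X] [InnerProductSpace ℝ X]
    [FiniteDimensional ℝ X] [MeasurableSpace X] [BorelSpace X]
    [NormedAddCommGroup F] [NormedSpace ℂ F] [CompleteSpace F] {f : X → F}
    (hf : Continuous f) (hfi : Integrable f)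
    (h : ∀ p : ℕ, ∃ C, ∀ w, ‖w‖ ^ p * ‖𝓕 f w‖ ≤ C) : ContDiff ℝ ∞ f := by
  have hmeas : AEStronglyMeasurable (𝓕 f) volume :=
    (VectorFourier.fourierIntegral_continuous Real.continuous_fourierChar
      (by exact continuous_inner) hfi).aestronglyMeasurable
  have hint : ∀ n : ℕ, Integrable fun w => ‖w‖ ^ n * ‖𝓕 f w‖ := by
    intro n
    -- With this exponent `(1 + ‖w‖)⁻ʳ` is integrable; it dominates the `n`-th moment once the
    -- bounds of orders `n` and `n + r` are combined.
    set r : ℕ := Module.finrank ℝ X + 1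
    obtain ⟨C₀, h₀⟩ := h n
    obtain ⟨C₁, h₁⟩ := h (n + r)
    have hr := integrable_one_add_norm (E := X) (μ := volume) (r := (r : ℕ))
      (by exact_mod_cast Nat.lt_succ_self _)
    refine (hr.const_mul (2 ^ r * (C₀ + C₁))).mono'
      ((continuous_norm.pow n).aestronglyMeasurable.mul hmeas.norm) (Eventually.of_forall ?_)
    intro w
    have hw := norm_nonneg w
    rw [Real.norm_of_nonneg (by positivity), Real.rpow_neg (by positivity), Real.rpow_natCast,
      ← div_eq_mul_inv, le_div_iff₀ (by positivity)]
    have hadd : (1 + ‖w‖) ^ r ≤ 2 ^ r * (1 + ‖w‖ ^ r) := by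
      rcases le_total ‖w‖ 1 with h1 | h1
      · calc (1 + ‖w‖) ^ r ≤ 2 ^ r := by gcongr; linarith
          _ ≤ 2 ^ r * (1 + ‖w‖ ^ r) := by
            have : (0 : ℝ) ≤ ‖w‖ ^ r := by positivity
            nlinarith [pow_pos (two_pos : (0 : ℝ) < 2) r]
      · calc (1 + ‖w‖) ^ r ≤ (2 * ‖w‖) ^ r := by gcongr; linarith
          _ = 2 ^ r * ‖w‖ ^ r := by rw [mul_pow]
          _ ≤ 2 ^ r * (1 + ‖w‖ ^ r) := by gcongr; linarith
    calc ‖w‖ ^ n * ‖𝓕 f w‖ * (1 + ‖w‖) ^ r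
        ≤ ‖w‖ ^ n * ‖𝓕 f w‖ * (2 ^ r * (1 + ‖w‖ ^ r)) := by gcongr
      _ = 2 ^ r * (‖w‖ ^ n * ‖𝓕 f w‖ + ‖w‖ ^ (n + r) * ‖𝓕 f w‖) := by ring
      _ ≤ 2 ^ r * (C₀ + C₁) := by gcongr <;> [exact h₀ w; exact h₁ w]
  have hFi : Integrable (𝓕 f) := by
    rw [← integrable_norm_iff hmeas]
    simpa using hint 0
  rw [← hf.fourierInv_fourier_eq hfi hFi]
  have h1 : ContDiff ℝ ∞ (𝓕 (𝓕 f)) := Real.contDiff_fourier (N := ⊤) fun n _ => hint n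
  have h2 : 𝓕⁻ (𝓕 f) = fun x => 𝓕 (𝓕 f) (-x) := funext fun x => Real.fourierInv_eq_fourier_neg _ _
  rw [h2]
  exact h1.comp contDiff_neg

/-- No mixed derivatives are needed: the `p`-th derivative along the `i`-th axis bounds `|wᵢ|ᵖ ‖𝓕 f
w‖` by its `L¹`-norm, and at each `w` the largest coordinate controls `‖w‖`. -/
theorem contDiff_of_bounded_lineDeriv {ι F : Type*} [Fintype ι]
    [NormedAddCommGroup F] [NormedSpace ℂ F] [CompleteSpace F] {f : EuclideanSpace ℝ ι → F}
    (hf : Continuous f) (hfc : HasCompactSupport f)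
    (D : ι → ℕ → EuclideanSpace ℝ ι → F) (hD₀ : ∀ i, D i 0 = f)
    (hD : ∀ i p x, HasLineDerivAt ℝ (D i p) (D i (p + 1) x) x (EuclideanSpace.basisFun ι ℝ i))
    (hb : ∀ i p, ∃ C, ∀ x, ‖D i p x‖ ≤ C) : ContDiff ℝ ∞ f := by
  have hfi : Integrable f := hf.integrable_of_hasCompactSupport hfc
  have hmeas : ∀ i p, StronglyMeasurable (D i p) := by
    intro i p
    induction p with
    | zero => rw [hD₀]; exact hf.stronglyMeasurable
    | succ p ih =>
      -- The functions `D i p` need not be continuous, but each is a pointwise limit of difference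
      -- quotients of its predecessor along this null sequence, hence measurable.
      have hseq : Tendsto (fun n : ℕ => ((n : ℝ) + 1)⁻¹) atTop (𝓝[≠] 0) := by
        refine tendsto_nhdsWithin_iff.2 ⟨?_, Eventually.of_forall fun n => ?_⟩
        · simpa using tendsto_one_div_add_atTop_nhds_zero_nat (𝕜 := ℝ)
        · exact inv_ne_zero (by positivity)
      refine stronglyMeasurable_of_tendsto atTop
        (f := fun (n : ℕ) x => (((n : ℝ) + 1)⁻¹)⁻¹ •
          (D i p (x + ((n : ℝ) + 1)⁻¹ • EuclideanSpace.basisFun ι ℝ i) - D i p x)) ?_ ?_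
      · intro n
        refine (((ih.comp_measurable ?_).sub ih).const_smul _)
        exact measurable_id.add_const _
      · refine tendsto_pi_nhds.2 fun x => ?_
        exact (hD i p x).tendsto_slope_zero.comp hseq
  -- Confinement to the compact support of `f` turns the bounds on `D i p` into integrability.
  have hzero : ∀ i p x, x ∉ tsupport f → D i p x = 0 := by
    intro i p
    induction p with
    | zero => intro x hx; rw [hD₀]; exact image_eq_zero_of_notMem_tsupport hx
    | succ p ih =>
      intro x hx
      refine (hD i p x).unique ?_
      have hev : (fun z => D i p z) =ᶠ[𝓝 x] fun _ => 0 := by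
        filter_upwards [(isClosed_tsupport f).isOpen_compl.mem_nhds hx] with z hz using ih z hz
      exact ((hasFDerivAt_const (0 : F) x).congr_of_eventuallyEq hev).hasLineDerivAt _
  have hint : ∀ i p, Integrable (D i p) := by
    intro i p
    obtain ⟨C, hC⟩ := hb i p
    have h1 : IntegrableOn (D i p) (tsupport f) := by
      have : IsFiniteMeasure (volume.restrict (tsupport f)) :=
        ⟨by simpa using hfc.measure_lt_top⟩
      exact Integrable.of_bound (hmeas i p).aestronglyMeasurable C (Eventually.of_forall hC)
    refine (integrableOn_iff_integrable_of_support_subset fun x hx => ?_).1 h1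
    by_contra h
    exact hx (hzero i p x h)
  have hfour : ∀ i p w, ‖𝓕 (D i p) w‖ = (2 * Real.pi * |w i|) ^ p * ‖𝓕 f w‖ := by
    intro i p w
    induction p with
    | zero => simp [hD₀]
    | succ p ih =>
      rw [fourier_hasLineDerivAt (hint i p) (hint i (p + 1)) (hD i p) w, norm_smul, ih]
      simp [abs_of_pos Real.pi_pos]
      ring
  refine contDiff_of_fourier_decay hf hfi fun p => ?_
  have hle : ∀ i w, |w i| ^ p * ‖𝓕 f w‖ ≤ ∫ x, ‖D i p x‖ := by
    intro i w
    calc |w i| ^ p * ‖𝓕 f w‖ ≤ (2 * Real.pi * |w i|) ^ p * ‖𝓕 f w‖ := by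
          gcongr
          nlinarith [Real.pi_gt_three, abs_nonneg (w i)]
      _ = ‖𝓕 (D i p) w‖ := (hfour i p w).symm
      _ ≤ _ := VectorFourier.norm_fourierIntegral_le_integral_norm _ _ _ _ _
  -- The first summand serves only the zero-dimensional case with `p = 0`, where there is no
  -- coordinate to maximize. The power of `card ι` comes from `‖w‖ ≤ card ι * max |wᵢ|`.
  refine ⟨‖𝓕 f 0‖ + (Fintype.card ι : ℝ) ^ p * ∑ i, ∫ x, ‖D i p x‖, fun w => ?_⟩
  have hpos : 0 ≤ (Fintype.card ι : ℝ) ^ p * ∑ i, ∫ x, ‖D i p x‖ := by positivity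
  have hnorm : ‖w‖ ≤ ∑ i, |w i| := by
    have := (EuclideanSpace.basisFun ι ℝ).sum_repr w
    calc ‖w‖ = ‖∑ i, w i • EuclideanSpace.basisFun ι ℝ i‖ := by
          conv_lhs => rw [← this]
          simp
      _ ≤ ∑ i, ‖w i • EuclideanSpace.basisFun ι ℝ i‖ := norm_sum_le _ _
      _ = ∑ i, |w i| := by simp [norm_smul]
  rcases isEmpty_or_nonempty ι with hι | hι
  · have hw0 : w = 0 := Subsingleton.elim _ _
    subst hw0
    rcases p with _ | p
    · simp
    · simp only [norm_zero, ne_eq, Nat.succ_ne_zero, not_false_eq_true, zero_pow, zero_mul]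
      positivity
  obtain ⟨j, -, hj⟩ := Finset.exists_max_image Finset.univ (fun i => |w i|) Finset.univ_nonempty
  have hwj : ‖w‖ ≤ Fintype.card ι * |w j| := by
    refine hnorm.trans ?_
    simpa using Finset.sum_le_card_nsmul Finset.univ (fun i => |w i|) _ hj
  calc ‖w‖ ^ p * ‖𝓕 f w‖ ≤ (Fintype.card ι * |w j|) ^ p * ‖𝓕 f w‖ := by gcongr
    _ = (Fintype.card ι : ℝ) ^ p * (|w j| ^ p * ‖𝓕 f w‖) := by rw [mul_pow]; ring
    _ ≤ (Fintype.card ι : ℝ) ^ p * ∑ i, ∫ x, ‖D i p x‖ := by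
        gcongr
        exact (hle j w).trans (Finset.single_le_sum (f := fun i => ∫ x, ‖D i p x‖)
          (fun i _ => by positivity) (Finset.mem_univ j))
    _ ≤ _ := by linarith [norm_nonneg (𝓕 f 0)]

theorem iteratedDeriv_line_add {X F : Type*} [AddCommGroup X] [Module ℝ X]
    [NormedAddCommGroup F] [NormedSpace ℝ F] (f : X → F) (p : ℕ) (x v : X) (t : ℝ) :
    iteratedDeriv p (fun s : ℝ => f (x + t • v + s • v)) 0
      = iteratedDeriv p (fun s : ℝ => f (x + s • v)) t := by
  have h := congrFun (iteratedDeriv_comp_const_add p (fun s : ℝ => f (x + s • v)) t) 0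
  simpa only [add_smul, add_assoc, add_zero] using h

theorem iteratedDeriv_comp_mul_left {F : Type*} [NormedAddCommGroup F] [NormedSpace ℝ F]
    (f : ℝ → F) (p : ℕ) (a : ℝ) :
    iteratedDeriv p (fun s => f (a * s)) = fun s => a ^ p • iteratedDeriv p f (a * s) := by
  induction p with
  | zero => simp
  | succ p ih =>
    ext s
    rw [iteratedDeriv_succ, ih, iteratedDeriv_succ, pow_succ, mul_smul, deriv_fun_const_smul_field]
    congr 1
    exact deriv_comp_mul_left a _ s

/-- Moving the base point along `v` only shifts the parameter of the line, so smoothness on this one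
line is enough. It lets the line derivatives serve as the family `D` in
`contDiff_of_bounded_lineDeriv`. -/
theorem hasLineDerivAt_iteratedDeriv_line {X F : Type*} [NormedAddCommGroup X] [NormedSpace ℝ X]
    [NormedAddCommGroup F] [NormedSpace ℝ F] {f : X → F} {x v : X}
    (h : ContDiffAt ℝ ∞ (fun s : ℝ => f (x + s • v)) 0) (p : ℕ) :
    HasLineDerivAt ℝ (fun z => iteratedDeriv p (fun s : ℝ => f (z + s • v)) 0)
      (iteratedDeriv (p + 1) (fun s : ℝ => f (x + s • v)) 0) x v := by
  simp only [HasLineDerivAt, iteratedDeriv_line_add]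
  rw [iteratedDeriv_succ]
  refine DifferentiableAt.hasDerivAt ?_
  have h1 : ContDiffAt ℝ 1 (iteratedFDeriv ℝ p fun s : ℝ => f (x + s • v)) 0 :=
    h.iteratedFDeriv_right (by simpa using by exact_mod_cast le_top)
  exact (ContinuousMultilinearMap.apply ℝ (fun _ : Fin p => ℝ) F
    (fun _ => 1)).differentiableAt.comp (0 : ℝ) (h1.differentiableAt one_ne_zero)

theorem iteratedDeriv_line {X F : Type*} [NormedAddCommGroup X] [NormedSpace ℝ X]
    [NormedAddCommGroup F] [NormedSpace ℝ F] {f : X → F} {Ω : Set X} (hΩ : IsOpen Ω)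
    (hf : ContDiffOn ℝ ∞ f Ω) (v : X) (p : ℕ) {x : X} (hx : x ∈ Ω) :
    iteratedDeriv p (fun s : ℝ => f (x + s • v)) 0 = iteratedFDeriv ℝ p f x fun _ => v := by
  induction p generalizing x with
  | zero => simp
  | succ p ih =>
    have hline : Tendsto (fun t : ℝ => x + t • v) (𝓝 0) (𝓝 x) := by
      have : Continuous fun t : ℝ => x + t • v := by fun_prop
      simpa using this.tendsto 0
    have hev : (iteratedDeriv p fun s : ℝ => f (x + s • v)) =ᶠ[𝓝 0]
        fun t => iteratedFDeriv ℝ p f (x + t • v) fun _ => v := by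
      filter_upwards [hline.eventually (hΩ.mem_nhds hx)] with t ht
      rw [← ih ht, iteratedDeriv_line_add]
    rw [iteratedDeriv_succ, hev.deriv_eq, iteratedFDeriv_succ_apply_left]
    have hd : HasFDerivAt (iteratedFDeriv ℝ p f) (fderiv ℝ (iteratedFDeriv ℝ p f) x) x := by
      have h1 : ContDiffAt ℝ ∞ f x := hf.contDiffAt (hΩ.mem_nhds hx)
      have : ContDiffAt ℝ 1 (iteratedFDeriv ℝ p f) x :=
        h1.iteratedFDeriv_right (by simpa using by exact_mod_cast le_top)
      exact (this.differentiableAt one_ne_zero).hasFDerivAt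
    have hl : HasDerivAt (fun t : ℝ => x + t • v) v 0 := by
      simpa using ((hasDerivAt_id (0 : ℝ)).smul_const v).const_add x
    have hd' : HasFDerivAt (iteratedFDeriv ℝ p f) (fderiv ℝ (iteratedFDeriv ℝ p f) x)
        (x + (0 : ℝ) • v) := by simpa using hd
    have h2 := hd'.comp_hasDerivAt (0 : ℝ) hl
    have h3 := ((ContinuousMultilinearMap.apply ℝ (fun _ : Fin p => X) F
      (fun _ => v)).hasFDerivAt).comp_hasDerivAt (0 : ℝ) h2
    exact h3.deriv

theorem IsCompact.exists_bound_of_locally_bounded {X F : Type*} [TopologicalSpace X]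
    [NormedAddCommGroup F] {K : Set X} (hK : IsCompact K) {D : X → F}
    (h : ∀ x ∈ K, ∃ C, ∀ᶠ z in 𝓝 x, ‖D z‖ ≤ C) : ∃ C, ∀ x ∈ K, ‖D x‖ ≤ C := by
  refine hK.induction_on (p := fun s => ∃ C, ∀ x ∈ s, ‖D x‖ ≤ C) ⟨0, by simp⟩ ?_ ?_ ?_
  · rintro s t hst ⟨C, hC⟩
    exact ⟨C, fun x hx => hC x (hst hx)⟩
  · rintro s t ⟨C, hC⟩ ⟨C', hC'⟩
    exact ⟨max C C', fun x hx => hx.elim (fun hx => (hC x hx).trans (le_max_left _ _))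
      fun hx => (hC' x hx).trans (le_max_right _ _)⟩
  · intro x hx
    obtain ⟨C, hC⟩ := h x hx
    exact ⟨_, mem_nhdsWithin_of_mem_nhds hC, C, fun z hz => hz⟩

/-- If the derivatives of `f` along the lines in the directions of a basis exist and are locally
bounded, then `f` is smooth. -/
theorem contDiffOn_of_locally_bounded_lineDeriv {ι X F : Type*} [Fintype ι]
    [NormedAddCommGroup X] [NormedSpace ℝ X] [FiniteDimensional ℝ X]
    [NormedAddCommGroup F] [NormedSpace ℂ F] [CompleteSpace F] (b : Module.Basis ι ℝ X)
    {Ω : Set X} (hΩ : IsOpen Ω) {f : X → F} (hf : ContinuousOn f Ω)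
    (hl : ∀ x ∈ Ω, ∀ i, ContDiffAt ℝ ∞ (fun s : ℝ => f (x + s • b i)) 0)
    (hb : ∀ i p, ∀ x ∈ Ω, ∃ C, ∀ᶠ z in 𝓝 x,
      ‖iteratedDeriv p (fun s : ℝ => f (z + s • b i)) 0‖ ≤ C) : ContDiffOn ℝ ∞ f Ω := by
  intro x₀ hx₀
  obtain ⟨R, hR, hRΩ⟩ := Metric.isOpen_iff.1 hΩ x₀ hx₀
  -- Localization: `χ • f` has compact support in `Ω` and equals `f` near `x₀`; by the Leibniz rule
  -- it inherits bounds on its line derivatives, now globally.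
  let χ : ContDiffBump x₀ := ⟨R / 4, R / 2, by positivity, by linarith⟩
  have hχ : tsupport χ ⊆ Ω := by
    rw [χ.tsupport_eq]
    exact (Metric.closedBall_subset_ball (by simp only [χ]; linarith)).trans hRΩ
  set g : X → F := fun x => χ x • f x with hg
  have hgs : tsupport g ⊆ tsupport χ := closure_mono fun x hx h => hx (by simp [hg, h])
  have hgc : Continuous g :=
    (χ.continuous.continuousOn.smul hf).continuous_of_tsupport_subset hΩ (hgs.trans hχ)
  have hgcs : HasCompactSupport g := χ.hasCompactSupport.smul_right
  have hχl : ∀ x v : X, ContDiff ℝ ∞ fun s : ℝ => χ (x + s • v) := fun x v =>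
    χ.contDiff.comp (contDiff_const.add (contDiff_id.smul contDiff_const))
  have hzero : ∀ x ∉ tsupport χ, ∀ v : X, (fun s : ℝ => g (x + s • v)) =ᶠ[𝓝 0] fun _ => 0 := by
    intro x hx v
    have hline : Tendsto (fun t : ℝ => x + t • v) (𝓝 0) (𝓝 x) := by
      have : Continuous fun t : ℝ => x + t • v := by fun_prop
      simpa using this.tendsto 0
    filter_upwards [hline.eventually ((isClosed_tsupport χ).isOpen_compl.mem_nhds hx)] with s hs
    exact image_eq_zero_of_notMem_tsupport fun h => hs (hgs h)
  have hgl : ∀ x i, ContDiffAt ℝ ∞ (fun s : ℝ => g (x + s • b i)) 0 := by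
    intro x i
    by_cases hx : x ∈ tsupport χ
    · exact (hχl x (b i)).contDiffAt.smul (hl x (hχ hx) i)
    · exact contDiffAt_const.congr_of_eventuallyEq (hzero x hx _)
  have hgb : ∀ i p, ∃ C, ∀ x, ‖iteratedDeriv p (fun s : ℝ => g (x + s • b i)) 0‖ ≤ C := by
    intro i p
    have hloc : ∃ C, ∀ x ∈ tsupport χ,
        ‖iteratedDeriv p (fun s : ℝ => g (x + s • b i)) 0‖ ≤ C := by
      refine χ.hasCompactSupport.isCompact.exists_bound_of_locally_bounded fun x hx => ?_
      choose C hC using fun q : ℕ => hb i q x (hχ hx)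
      have hχb : ∀ q : ℕ, ∃ B, ∀ᶠ z in 𝓝 x,
          ‖iteratedDeriv q (fun s : ℝ => χ (z + s • b i)) 0‖ ≤ B := by
        intro q
        have hcont : Continuous fun z => ‖iteratedDeriv q (fun s : ℝ => χ (z + s • b i)) 0‖ := by
          have h1 : ∀ z, iteratedDeriv q (fun s : ℝ => χ (z + s • b i)) 0
              = iteratedFDeriv ℝ q χ z fun _ => b i := fun z =>
            iteratedDeriv_line isOpen_univ χ.contDiff.contDiffOn _ _ (Set.mem_univ z)
          simp only [h1]
          have h2 : Continuous (iteratedFDeriv ℝ q χ) :=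
            (χ.contDiff (n := ⊤)).continuous_iteratedFDeriv (by exact_mod_cast le_top)
          exact ((ContinuousMultilinearMap.apply ℝ (fun _ : Fin q => X) ℝ
            (fun _ => b i)).continuous.comp h2).norm
        exact ⟨_, (hcont.tendsto x).eventually (Iic_mem_nhds (lt_add_one _))⟩
      choose B hB using hχb
      refine ⟨∑ q ∈ Finset.range (p + 1), (p.choose q : ℝ) * (B q * C (p - q)), ?_⟩
      have h1 := (Finset.range (p + 1)).eventually_all.2 fun q _ => hB q
      have h2 := (Finset.range (p + 1)).eventually_all.2 fun q _ => hC (p - q)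
      filter_upwards [h1, h2, hΩ.mem_nhds (hχ hx)] with z hz₁ hz₂ hz
      have hprod : iteratedDeriv p (fun s : ℝ => g (z + s • b i)) 0
          = ∑ q ∈ Finset.range (p + 1), p.choose q •
            iteratedDeriv q (fun s : ℝ => χ (z + s • b i)) 0 •
              iteratedDeriv (p - q) (fun s : ℝ => f (z + s • b i)) 0 := by
        have hle : ((p : ℕ) : WithTop ℕ∞) ≤ ∞ := by exact_mod_cast le_top
        have := iteratedDerivWithin_smul (n := p) (Set.mem_univ (0 : ℝ)) uniqueDiffOn_univ
          ((hχl z (b i)).contDiffAt.contDiffWithinAt.of_le hle)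
          ((hl z hz i).contDiffWithinAt.of_le hle)
        simpa only [iteratedDerivWithin_univ] using! this
      rw [hprod]
      refine (norm_sum_le _ _).trans (Finset.sum_le_sum fun q hq => ?_)
      rw [← Nat.cast_smul_eq_nsmul ℝ, norm_smul, norm_smul, Real.norm_natCast]
      have := hz₁ q hq
      have := hz₂ q hq
      have := (norm_nonneg _).trans (hz₁ q hq)
      gcongr
    obtain ⟨C, hC⟩ := hloc
    refine ⟨max C 0, fun x => ?_⟩
    by_cases hx : x ∈ tsupport χ
    · exact (hC x hx).trans (le_max_left _ _)
    · rw [(hzero x hx (b i)).iteratedDeriv_eq p, iteratedDeriv_const]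
      simp
  -- The Fourier criterion concerns the standard basis of a Euclidean space; `L` carries that basis
  -- to `b`.
  let L : EuclideanSpace ℝ ι ≃L[ℝ] X :=
    (EuclideanSpace.equiv ι ℝ).trans b.equivFun.symm.toContinuousLinearEquiv
  have hL : ∀ i, L (EuclideanSpace.basisFun ι ℝ i) = b i := by
    intro i
    classical
    simp [L, Module.Basis.equivFun_symm_apply]
  have key : ContDiff ℝ ∞ (g ∘ L) := by
    refine contDiff_of_bounded_lineDeriv (hgc.comp L.continuous)
      (hgcs.comp_homeomorph L.toHomeomorph)
      (fun i p z => iteratedDeriv p (fun s : ℝ => g (L z + s • b i)) 0) (fun i => ?_)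
      (fun i p z => ?_) fun i p => ?_
    · ext z
      simp
    · have := hasLineDerivAt_iteratedDeriv_line (hgl (L z) i) p
      simpa [HasLineDerivAt, hL] using this
    · obtain ⟨C, hC⟩ := hgb i p
      exact ⟨C, fun z => hC (L z)⟩
  have hgsm : ContDiff ℝ ∞ g := by
    have := key.comp L.symm.contDiff
    simpa [Function.comp_def] using this
  refine (hgsm.contDiffAt.congr_of_eventuallyEq ?_).contDiffWithinAt
  filter_upwards [χ.eventuallyEq_one] with z hz
  simp [hg, hz]

/-! ## The special curve lemma and Boman's theorem -/

theorem ContDiff.exists_bound_iteratedFDeriv {X F : Type*} [NormedAddCommGroup X]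
    [NormedSpace ℝ X] [NormedAddCommGroup F] [NormedSpace ℝ F] {g : X → F}
    (hg : ContDiff ℝ ∞ g) (hc : HasCompactSupport g) (k : ℕ) :
    ∃ B, 0 ≤ B ∧ ∀ i ≤ k, ∀ x, ‖iteratedFDeriv ℝ i g x‖ ≤ B := by
  have h : ∀ i : ℕ, ∃ B, ∀ x, ‖iteratedFDeriv ℝ i g x‖ ≤ B := fun i =>
    (hc.iteratedFDeriv i).exists_bound_of_continuous
      (hg.continuous_iteratedFDeriv (by exact_mod_cast le_top))
  choose B hB using h
  have hB0 : ∀ i, 0 ≤ B i := fun i => (norm_nonneg _).trans (hB i 0)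
  refine ⟨∑ i ∈ Finset.range (k + 1), B i, Finset.sum_nonneg fun i _ => hB0 i,
    fun i hi x => (hB i x).trans ?_⟩
  exact Finset.single_le_sum (fun i _ => hB0 i) (Finset.mem_range.2 (by omega))

theorem norm_iteratedFDeriv_smul_const_le {F : Type*} [NormedAddCommGroup F] [NormedSpace ℝ F]
    {g : ℝ → ℝ} (hg : ContDiff ℝ ∞ g) (i : ℕ) (t : ℝ) (v : F) :
    ‖iteratedFDeriv ℝ i (fun s => g s • v) t‖ ≤ ‖iteratedFDeriv ℝ i g t‖ * ‖v‖ := by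
  have h := (ContinuousLinearMap.toSpanSingleton ℝ v).norm_iteratedFDeriv_comp_left
    (hg.contDiffAt (x := t)) (n := i) (by exact_mod_cast le_top)
  rw [ContinuousLinearMap.norm_toSpanSingleton, mul_comm] at h
  exact h

/-- A sequence of points that converges sufficiently fast to `x` lies on a smooth curve through
`x` that runs for a while in direction `v` at each of the points. -/
theorem exists_contDiff_curve_through {X : Type*} [NormedAddCommGroup X] [NormedSpace ℝ X]
    [CompleteSpace X] (x v : X) {r : ℝ} (hr : 0 < r) :
    ∃ t ε δ : ℕ → ℝ, Tendsto t atTop (𝓝 0) ∧ (∀ k, 0 < ε k) ∧ (∀ k, 0 < δ k) ∧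
      ∀ y : ℕ → X, (∀ k, ‖y k - x‖ ≤ δ k) → ∃ c : ℝ → X, ContDiff ℝ ∞ c ∧
        (∀ τ, c τ ∈ Metric.ball x r) ∧ c 0 = x ∧
        ∀ k, ∀ᶠ s in 𝓝 (0 : ℝ), c (t k + s) = y k + (ε k * s) • v := by
  -- The curve is `x` plus a series of bumps, the `k`-th of which lives near the time `2⁻ᵏ` and
  -- carries the displacement `y k - x` together with a short run in direction `v`.
  let t : ℕ → ℝ := fun k => (1 / 2) ^ k
  let φ : ∀ k : ℕ, ContDiffBump (t k) := fun k =>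
    ⟨(1 / 2) ^ k / 8, (1 / 2) ^ k / 4, by positivity,
      by have : (0 : ℝ) < (1 / 2) ^ k := by positivity
         linarith⟩
  have hφ : ∀ k, ContDiff ℝ ∞ (φ k) := fun k => (φ k).contDiff
  let ψ : ℕ → ℝ → ℝ := fun k s => φ k s * (s - t k)
  have hψ : ∀ k, ContDiff ℝ ∞ (ψ k) := fun k => (hφ k).mul (contDiff_id.sub contDiff_const)
  have hψc : ∀ k, HasCompactSupport (ψ k) := fun k => (φ k).hasCompactSupport.mul_right
  choose A hA0 hA using fun k => (hφ k).exists_bound_iteratedFDeriv (φ k).hasCompactSupport k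
  choose B hB0 hB using fun k => (hψ k).exists_bound_iteratedFDeriv (hψc k) k
  -- `η k` is the budget for all derivatives up to order `k` of the `k`-th bump. For each fixed
  -- order all but finitely many terms then obey a summable bound, and the total `r / 2` keeps the
  -- curve in the ball. The constants `ε k` and `δ k` give each of the two summands of the bump half
  -- of the budget, and they do not depend on the points `y`.
  let η : ℕ → ℝ := fun k => (r / 4) * (1 / 2) ^ k
  have hη : ∀ k, 0 < η k := fun k => by positivity
  have hηs : HasSum η (r / 2) := by
    have h := hasSum_geometric_two.mul_left (r / 4)
    rwa [show r / 4 * 2 = r / 2 by ring] at h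
  refine ⟨t, fun k => η k / (2 * ((B k + 1) * (‖v‖ + 1))), fun k => η k / (2 * (A k + 1)),
    tendsto_pow_atTop_nhds_zero_of_lt_one (by norm_num) (by norm_num), fun k => ?_, fun k => ?_,
    fun y hy => ?_⟩
  · have := hη k
    have := hB0 k
    positivity
  · have := hη k
    have := hA0 k
    positivity
  set ε : ℕ → ℝ := fun k => η k / (2 * ((B k + 1) * (‖v‖ + 1))) with hε
  let w : ℕ → ℝ → X := fun k s => φ k s • (y k - x) + ψ k s • (ε k • v)
  have hw : ∀ k, ContDiff ℝ ∞ (w k) := fun k =>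
    ((hφ k).smul contDiff_const).add ((hψ k).smul contDiff_const)
  have hwb : ∀ k, ∀ i ≤ k, ∀ s, ‖iteratedFDeriv ℝ i (w k) s‖ ≤ η k := by
    intro k i hi s
    have hle : ((i : ℕ) : WithTop ℕ∞) ≤ ∞ := by exact_mod_cast le_top
    have hadd : iteratedFDeriv ℝ i (w k) s = iteratedFDeriv ℝ i (fun s => φ k s • (y k - x)) s
        + iteratedFDeriv ℝ i (fun s => ψ k s • (ε k • v)) s :=
      iteratedFDeriv_add_apply (((hφ k).smul contDiff_const).contDiffAt.of_le hle)
        (((hψ k).smul contDiff_const).contDiffAt.of_le hle)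
    have h1 : ‖iteratedFDeriv ℝ i (fun s => φ k s • (y k - x)) s‖ ≤ η k / 2 := by
      refine (norm_iteratedFDeriv_smul_const_le (hφ k) i s _).trans ?_
      have hA' := hA0 k
      have hη' := (hη k).le
      calc ‖iteratedFDeriv ℝ i (φ k) s‖ * ‖y k - x‖ ≤ (A k + 1) * (η k / (2 * (A k + 1))) :=
            mul_le_mul ((hA k i hi s).trans (by linarith)) (hy k) (norm_nonneg _) (by positivity)
        _ = η k / 2 := by field_simp
    have h2 : ‖iteratedFDeriv ℝ i (fun s => ψ k s • (ε k • v)) s‖ ≤ η k / 2 := by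
      refine (norm_iteratedFDeriv_smul_const_le (hψ k) i s _).trans ?_
      have hB' := hB0 k
      have hη' := (hη k).le
      have hεk : 0 ≤ ε k := by simp only [hε]; positivity
      rw [norm_smul, Real.norm_of_nonneg hεk]
      calc ‖iteratedFDeriv ℝ i (ψ k) s‖ * (ε k * ‖v‖) ≤ (B k + 1) * (ε k * (‖v‖ + 1)) := by
            refine mul_le_mul ((hB k i hi s).trans (by linarith)) ?_ (by positivity)
              (by positivity)
            gcongr
            linarith
        _ = η k / 2 := by simp only [hε]; field_simp
    rw [hadd]
    exact (norm_add_le _ _).trans (by linarith)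
  have hsupp : ∀ k s, (1 / 2) ^ k / 4 ≤ |s - t k| → w k s = 0 := by
    intro k s hs
    have h0 : φ k s = 0 := (φ k).zero_of_le_dist (by rw [Real.dist_eq]; exact hs)
    simp [w, ψ, h0]
  refine ⟨fun s => x + ∑' k, w k s, contDiff_const.add ?_, fun s => ?_, ?_, fun k => ?_⟩
  · refine contDiff_tsum_of_eventually (N := ⊤) (v := fun _ => η) hw (fun _ _ => hηs.summable)
      fun i _ => ?_
    rw [Nat.cofinite_eq_atTop]
    filter_upwards [eventually_ge_atTop i] with k hk s using hwb k i hk s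
  · rw [Metric.mem_ball, dist_eq_norm, add_sub_cancel_left]
    refine (tsum_of_norm_bounded hηs fun k => ?_).trans_lt (by linarith)
    simpa using hwb k 0 (Nat.zero_le k) s
  · have : ∀ k, w k 0 = 0 := fun k => hsupp k 0 (by
      have : (0 : ℝ) < (1 / 2) ^ k := by positivity
      simp only [t, zero_sub, abs_neg, abs_of_pos this]
      linarith)
    simp [this]
  · have hpos : (0 : ℝ) < (1 / 2) ^ k / 8 := by positivity
    filter_upwards [Metric.ball_mem_nhds (0 : ℝ) hpos] with s hs
    rw [mem_ball_zero_iff, Real.norm_eq_abs] at hs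
    have hother : ∀ j ≠ k, w j (t k + s) = 0 := by
      intro j hj
      refine hsupp j _ ?_
      -- Distinct dyadic times differ by at least half of the larger one, so the other bumps vanish
      -- near `t k`.
      rcases lt_or_gt_of_ne hj with h | h
      · have h1 : ((1 : ℝ) / 2) ^ k ≤ (1 / 2) ^ j / 2 := by
          calc ((1 : ℝ) / 2) ^ k ≤ (1 / 2) ^ (j + 1) :=
                pow_le_pow_of_le_one (by norm_num) (by norm_num) h
            _ = _ := by ring
        simp only [t]
        rw [abs_lt] at hs
        rw [le_abs]
        right
        linarith [hs.2]
      · have h1 : ((1 : ℝ) / 2) ^ j ≤ (1 / 2) ^ k / 2 := by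
          calc ((1 : ℝ) / 2) ^ j ≤ (1 / 2) ^ (k + 1) :=
                pow_le_pow_of_le_one (by norm_num) (by norm_num) h
            _ = _ := by ring
        simp only [t]
        rw [abs_lt] at hs
        rw [le_abs]
        left
        linarith [hs.1]
    have hone : φ k (t k + s) = 1 := (φ k).one_of_mem_closedBall (by
      rw [Metric.mem_closedBall, Real.dist_eq, add_sub_cancel_left]
      exact hs.le)
    rw [tsum_eq_single k hother]
    simp only [w, ψ, hone, one_smul, add_sub_cancel_left, one_mul, smul_smul, mul_comm s]
    abel

/-- **Boman's theorem**: a mapping that maps smooth curves to smooth curves is smooth. -/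
theorem contDiffOn_of_comp_curve {X F : Type*}
    [NormedAddCommGroup X] [NormedSpace ℝ X] [FiniteDimensional ℝ X]
    [NormedAddCommGroup F] [NormedSpace ℂ F] [CompleteSpace F]
    {Ω : Set X} (hΩ : IsOpen Ω) {f : X → F}
    (hf : ∀ c : ℝ → X, ContDiff ℝ ∞ c → (∀ τ, c τ ∈ Ω) → ContDiff ℝ ∞ (f ∘ c)) :
    ContDiffOn ℝ ∞ f Ω := by
  have : CompleteSpace X := FiniteDimensional.complete ℝ X
  have hball : ∀ x ∈ Ω, ∃ r > 0, Metric.ball x r ⊆ Ω := Metric.isOpen_iff.1 hΩ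
  have hscale : ∀ (z v : X) (a : ℝ) (p : ℕ),
      iteratedDeriv p (fun s : ℝ => f (z + (a * s) • v)) 0
        = a ^ p • iteratedDeriv p (fun s : ℝ => f (z + s • v)) 0 := fun z v a p => by
    simpa using congrFun (iteratedDeriv_comp_mul_left (fun s : ℝ => f (z + s • v)) p a) 0
  refine contDiffOn_of_locally_bounded_lineDeriv (Module.finBasis ℝ X) hΩ ?_ ?_ ?_
  -- Continuity: otherwise some points `y k` converge to `x` as fast as desired while `f (y k)`
  -- stays away from `f x`, and a smooth curve through all of them contradicts the continuity of `f
  -- ∘ c`.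
  · intro x hx
    refine ContinuousAt.continuousWithinAt ?_
    obtain ⟨r, hr, hrΩ⟩ := hball x hx
    obtain ⟨t, ε, δ, ht, hε, hδ, H⟩ := exists_contDiff_curve_through x 0 hr
    by_contra hcon
    rw [Metric.continuousAt_iff'] at hcon
    push Not at hcon
    obtain ⟨e, he, hcon⟩ := hcon
    have hy : ∀ k, ∃ y, ‖y - x‖ ≤ δ k ∧ e ≤ dist (f y) (f x) := by
      intro k
      obtain ⟨y, hy, hy'⟩ := (hcon.and_eventually (Metric.ball_mem_nhds x (hδ k))).exists
      exact ⟨y, by rw [← dist_eq_norm]; exact (Metric.mem_ball.1 hy').le, hy⟩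
    choose y hy hye using hy
    obtain ⟨c, hc, hcb, hc0, hcy⟩ := H y hy
    have hcont := (hf c hc fun τ => hrΩ (hcb τ)).continuous
    have hlim := (hcont.tendsto 0).comp ht
    obtain ⟨k, hk⟩ := (hlim.eventually (Metric.ball_mem_nhds _ he)).exists
    have hk' : c (t k) = y k := by simpa using (hcy k).self_of_nhds
    simp only [Function.comp, hk', hc0] at hk
    exact absurd hk (not_lt.2 (hye k))
  · intro x hx i
    obtain ⟨r, hr, hrΩ⟩ := hball x hx
    obtain ⟨t, ε, δ, ht, hε, hδ, H⟩ := exists_contDiff_curve_through x (Module.finBasis ℝ X i) hr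
    -- A full line may leave `Ω`. The curve through the constant sequence `x` stays in `Ω` and near
    -- time `t 0` runs along the line with speed `ε 0`.
    obtain ⟨c, hc, hcb, -, hcy⟩ := H (fun _ => x) fun k => by simpa using (hδ k).le
    have hsm : ContDiff ℝ ∞ fun s => f (c (t 0 + (ε 0)⁻¹ * s)) :=
      (hf c hc fun τ => hrΩ (hcb τ)).comp
        (contDiff_const.add (contDiff_const.mul contDiff_id))
    refine hsm.contDiffAt.congr_of_eventuallyEq ?_
    have hlim : Tendsto (fun s : ℝ => (ε 0)⁻¹ * s) (𝓝 0) (𝓝 0) := by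
      simpa using (continuous_const_mul (ε 0)⁻¹).tendsto (0 : ℝ)
    filter_upwards [hlim.eventually (hcy 0)] with s hs
    rw [hs, mul_inv_cancel_left₀ (hε 0).ne']
  · intro i p x hx
    obtain ⟨r, hr, hrΩ⟩ := hball x hx
    obtain ⟨t, ε, δ, ht, hε, hδ, H⟩ := exists_contDiff_curve_through x (Module.finBasis ℝ X i) hr
    by_contra hcon
    push Not at hcon
    -- The curve passes `y k` with speed `ε k`, which multiplies the `p`-th derivative by `ε k ^ p`.
    -- The threshold `k / ε k ^ p` still makes the `p`-th derivative of `f ∘ c` exceed `k` at `t k`,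
    -- although `t k → 0`.
    have hy : ∀ k : ℕ, ∃ y, ‖y - x‖ ≤ δ k ∧ k / ε k ^ p <
        ‖iteratedDeriv p (fun s : ℝ => f (y + s • Module.finBasis ℝ X i)) 0‖ := by
      intro k
      obtain ⟨y, hy, hy'⟩ := ((hcon (k / ε k ^ p)).and_eventually
        (Metric.ball_mem_nhds x (hδ k))).exists
      exact ⟨y, by rw [← dist_eq_norm]; exact (Metric.mem_ball.1 hy').le, hy⟩
    choose y hy hye using hy
    obtain ⟨c, hc, hcb, hc0, hcy⟩ := H y hy
    have hcont : Continuous (iteratedDeriv p (f ∘ c)) :=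
      (hf c hc fun τ => hrΩ (hcb τ)).continuous_iteratedDeriv p (by exact_mod_cast le_top)
    have hlim := ((hcont.tendsto 0).comp ht).norm
    have hlarge : ∀ k : ℕ, (k : ℝ) < ‖iteratedDeriv p (f ∘ c) (t k)‖ := by
      intro k
      have h1 : iteratedDeriv p (f ∘ c) (t k) = iteratedDeriv p (fun s => f (c (t k + s))) 0 := by
        simpa using (congrFun (iteratedDeriv_comp_const_add p (f ∘ c) (t k)) 0).symm
      have h2 : (fun s => f (c (t k + s))) =ᶠ[𝓝 0]
          fun s => f (y k + (ε k * s) • Module.finBasis ℝ X i) := by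
        filter_upwards [hcy k] with s hs
        rw [hs]
      rw [h1, h2.iteratedDeriv_eq p, hscale, norm_smul, norm_pow, Real.norm_of_nonneg (hε k).le]
      have := (div_lt_iff₀ (pow_pos (hε k) p)).1 (hye k)
      rwa [mul_comm] at this
    exact not_tendsto_nhds_of_tendsto_atTop (tendsto_atTop_mono (fun k => (hlarge k).le)
      tendsto_natCast_atTop_atTop) _ hlim

/-! ## Smooth curves in topological vector spaces -/

namespace UnitaryMoment

section Curves

variable {V W : Type*} [AddCommGroup V] [Module ℝ V] [TopologicalSpace V]
  [AddCommGroup W] [Module ℝ W] [TopologicalSpace W]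

/-- Coinduction: iterating the choice of a derivative inside the class `P` produces all higher
derivatives, so they never have to be written down explicitly. -/
theorem IsSmoothCurve.of_forall_exists_deriv {P : (ℝ → V) → Prop}
    (h : ∀ c, P c → Continuous c ∧ ∃ c', P c' ∧ ∀ t, HasCurveDerivAt c (c' t) t)
    {c : ℝ → V} (hc : P c) : IsSmoothCurve c := by
  choose! h0 d hd hd' using h
  have hP : ∀ n, P (d^[n] c) := fun n => by
    induction n with
    | zero => exact hc
    | succ n ih => rw [Function.iterate_succ_apply']; exact hd _ ih
  refine ⟨fun n => d^[n] c, rfl, fun n => ⟨h0 _ (hP n), fun t => ?_⟩⟩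
  have h := hd' _ (hP n) t
  rwa [← Function.iterate_succ_apply' d n c] at h

theorem IsSmoothCurve.exists_smooth_deriv {c : ℝ → V} (hc : IsSmoothCurve c) :
    ∃ c', IsSmoothCurve c' ∧ ∀ t, HasCurveDerivAt c (c' t) t := by
  obtain ⟨D, rfl, hD⟩ := hc
  exact ⟨D 1, ⟨fun n => D (n + 1), rfl, fun n => hD (n + 1)⟩, (hD 0).2⟩

theorem IsSmoothCurve.continuous {c : ℝ → V} (hc : IsSmoothCurve c) : Continuous c := by
  obtain ⟨D, rfl, hD⟩ := hc
  exact (hD 0).1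

theorem hasCurveDerivAt_iff_hasDerivAt {F : Type*} [NormedAddCommGroup F] [NormedSpace ℝ F]
    {c : ℝ → F} {v : F} {t : ℝ} : HasCurveDerivAt c v t ↔ HasDerivAt c v t :=
  hasDerivAt_iff_tendsto_slope_zero.symm

theorem isSmoothCurve_iff_contDiff {F : Type*} [NormedAddCommGroup F] [NormedSpace ℝ F]
    {c : ℝ → F} : IsSmoothCurve c ↔ ContDiff ℝ ∞ c := by
  constructor
  · rintro ⟨D, rfl, hD⟩
    have hder : ∀ n t, HasDerivAt (D n) (D (n + 1) t) t := fun n t =>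
      hasCurveDerivAt_iff_hasDerivAt.1 ((hD n).2 t)
    have hiter : ∀ n, iteratedDeriv n (D 0) = D n := fun n => by
      induction n with
      | zero => simp
      | succ n ih => rw [iteratedDeriv_succ, ih]; exact funext fun t => (hder n t).deriv
    refine contDiff_of_differentiable_iteratedDeriv (n := ⊤) fun m _ => ?_
    rw [hiter]
    exact fun t => (hder m t).differentiableAt
  · intro hc
    refine IsSmoothCurve.of_forall_exists_deriv (P := fun c => ContDiff ℝ ∞ c) (fun c hc => ?_) hc
    refine ⟨hc.continuous, deriv c, (contDiff_infty_iff_deriv.1 hc).2, fun t => ?_⟩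
    exact hasCurveDerivAt_iff_hasDerivAt.2
      ((contDiff_infty_iff_deriv.1 hc).1 t).hasDerivAt

theorem HasCurveDerivAt.clm {c : ℝ → V} {v : V} {t : ℝ} (L : V →L[ℝ] W)
    (hc : HasCurveDerivAt c v t) : HasCurveDerivAt (fun s => L (c s)) (L v) t := by
  refine ((L.continuous.tendsto v).comp hc).congr fun s => ?_
  simp

theorem IsSmoothCurve.clm {c : ℝ → V} (L : V →L[ℝ] W) (hc : IsSmoothCurve c) :
    IsSmoothCurve (fun s => L (c s)) := by
  obtain ⟨D, rfl, hD⟩ := hc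
  exact ⟨fun n s => L (D n s), rfl, fun n => ⟨L.continuous.comp (hD n).1,
    fun t => ((hD n).2 t).clm L⟩⟩

theorem IsSmoothCurve.pi {n : ℕ} {c : ℝ → Fin n → V} (hc : ∀ i, IsSmoothCurve fun t => c t i) :
    IsSmoothCurve c := by
  choose D hD0 hD using hc
  refine ⟨fun p t i => D i p t, ?_, fun p => ⟨continuous_pi fun i => (hD i p).1, fun t => ?_⟩⟩
  · ext t i
    exact congrFun (hD0 i) t
  · exact tendsto_pi_nhds.2 fun i => (hD i p).2 t

theorem IsSmoothCurve.fst {c : ℝ → V × W} (hc : IsSmoothCurve c) :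
    IsSmoothCurve fun t => (c t).1 :=
  hc.clm (ContinuousLinearMap.fst ℝ V W)

theorem IsSmoothCurve.snd {c : ℝ → V × W} (hc : IsSmoothCurve c) :
    IsSmoothCurve fun t => (c t).2 :=
  hc.clm (ContinuousLinearMap.snd ℝ V W)

theorem IsSmoothCurve.apply {n : ℕ} {c : ℝ → Fin n → V} (hc : IsSmoothCurve c) (i : Fin n) :
    IsSmoothCurve fun t => c t i :=
  hc.clm (ContinuousLinearMap.proj (R := ℝ) (φ := fun _ : Fin n => V) i)

theorem IsSmoothMap.prodMk {U : Type*} [AddCommGroup U] [Module ℝ U] [TopologicalSpace U]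
    {f : U → V} {g : U → W} (hf : IsSmoothMap f) (hg : IsSmoothMap g) :
    IsSmoothMap fun x => (f x, g x) :=
  fun c hc => (hf c hc).prodMk (hg c hc)

theorem IsSmoothMap.comp {U : Type*} [AddCommGroup U] [Module ℝ U] [TopologicalSpace U]
    {g : V → W} {f : U → V} (hg : IsSmoothMap g) (hf : IsSmoothMap f) :
    IsSmoothMap fun x => g (f x) :=
  fun c hc => hg _ (hf c hc)

theorem isSmoothMap_id : IsSmoothMap fun x : V => x :=
  fun _ hc => hc

/-- Carathéodory's form of the derivative: without a quotient, the chain and product rules reduce to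
algebra with continuous slopes, which works in any topological vector space. -/
theorem hasCurveDerivAt_iff_exists [ContinuousSMul ℝ V] [ContinuousAdd V]
    {c : ℝ → V} {v : V} {t : ℝ} : HasCurveDerivAt c v t ↔
      ∃ q : ℝ → V, ContinuousAt q 0 ∧ q 0 = v ∧ ∀ s, c (t + s) = c t + s • q s := by
  constructor
  · intro h
    refine ⟨Function.update (fun s : ℝ => s⁻¹ • (c (t + s) - c t)) 0 v,
      continuousAt_update_same.2 h, by simp, fun s => ?_⟩
    rcases eq_or_ne s 0 with rfl | hs
    · simp
    · simp [hs]
  · rintro ⟨q, hq, rfl, h⟩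
    refine (hq.tendsto.mono_left nhdsWithin_le_nhds).congr' ?_
    filter_upwards [self_mem_nhdsWithin] with s hs
    have hs' : s ≠ 0 := hs
    simp [h, smul_smul, hs']

variable [ContinuousSMul ℝ V] [IsTopologicalAddGroup V]

theorem HasCurveDerivAt.comp {c : ℝ → V} {v : V} {φ : ℝ → ℝ} {φ' t : ℝ}
    (hc : HasCurveDerivAt c v (φ t)) (hφ : HasCurveDerivAt φ φ' t) :
    HasCurveDerivAt (fun s => c (φ s)) (φ' • v) t := by
  obtain ⟨q, hq, rfl, hc'⟩ := hasCurveDerivAt_iff_exists.1 hc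
  obtain ⟨p, hp, rfl, hφ'⟩ := hasCurveDerivAt_iff_exists.1 hφ
  refine hasCurveDerivAt_iff_exists.2 ⟨fun s => p s • q (s * p s), ?_, by simp, fun s => ?_⟩
  · have h2 : ContinuousAt (fun s => q (s * p s)) 0 :=
      ContinuousAt.comp (g := q) (by simpa using hq) (by fun_prop)
    exact hp.smul h2
  · simp only [hφ', hc', smul_eq_mul, smul_smul]

theorem HasCurveDerivAt.fun_smul {a : ℝ → ℝ} {a' : ℝ} {c : ℝ → V} {v : V} {t : ℝ}
    (ha : HasCurveDerivAt a a' t) (hc : HasCurveDerivAt c v t) :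
    HasCurveDerivAt (fun s => a s • c s) (a' • c t + a t • v) t := by
  obtain ⟨q, hq, rfl, hc'⟩ := hasCurveDerivAt_iff_exists.1 hc
  obtain ⟨p, hp, rfl, ha'⟩ := hasCurveDerivAt_iff_exists.1 ha
  refine hasCurveDerivAt_iff_exists.2 ⟨fun s => p s • c t + a t • q s + (s * p s) • q s, ?_,
    by simp, fun s => ?_⟩
  · exact ((hp.smul continuousAt_const).add (continuousAt_const.smul hq)).add
      ((continuousAt_id.mul hp).smul hq)
  · simp only [ha', hc']
    module

theorem IsSmoothCurve.smul_comp {c : ℝ → V} (hc : IsSmoothCurve c) {a φ : ℝ → ℝ}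
    (ha : ContDiff ℝ ∞ a) (hφ : ContDiff ℝ ∞ φ) : IsSmoothCurve fun t => a t • c (φ t) := by
  obtain ⟨D, rfl, hD⟩ := hc
  -- Finite sums of curves `b • D n ∘ φ` are closed under differentiation, by the product and chain
  -- rules.
  let S : Set (ℝ → V) := {e | ∃ (b : ℝ → ℝ) (n : ℕ), ContDiff ℝ ∞ b ∧
    e = fun t => b t • D n (φ t)}
  refine IsSmoothCurve.of_forall_exists_deriv (P := fun e => e ∈ AddSubmonoid.closure S) ?_
    (AddSubmonoid.subset_closure ⟨a, 0, ha, rfl⟩)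
  intro e he
  induction he using AddSubmonoid.closure_induction with
  | mem e he =>
    obtain ⟨b, n, hb, rfl⟩ := he
    have hder : ∀ {g : ℝ → ℝ}, ContDiff ℝ ∞ g → ∀ t, HasCurveDerivAt g (deriv g t) t :=
      fun hg t => hasCurveDerivAt_iff_hasDerivAt.2 ((contDiff_infty_iff_deriv.1 hg).1 t).hasDerivAt
    refine ⟨hb.continuous.smul ((hD n).1.comp hφ.continuous),
      (fun t => deriv b t • D n (φ t)) + fun t => (b t * deriv φ t) • D (n + 1) (φ t),
      add_mem (AddSubmonoid.subset_closure ⟨_, n, (contDiff_infty_iff_deriv.1 hb).2, rfl⟩)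
        (AddSubmonoid.subset_closure ⟨_, n + 1, hb.mul (contDiff_infty_iff_deriv.1 hφ).2, rfl⟩),
      fun t => ?_⟩
    have := (hder hb t).fun_smul (((hD n).2 (φ t)).comp (hder hφ t))
    simpa only [Pi.add_apply, mul_smul] using this
  | zero =>
    exact ⟨continuous_const, 0, zero_mem _, fun t => by simpa [HasCurveDerivAt] using tendsto_const_nhds⟩
  | add e f _ _ he hf =>
    obtain ⟨he0, e', he', he1⟩ := he
    obtain ⟨hf0, f', hf', hf1⟩ := hf
    refine ⟨he0.add hf0, e' + f', add_mem he' hf', fun t => ?_⟩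
    refine ((he1 t).add (hf1 t)).congr fun s => ?_
    simp only [Pi.add_apply]
    module

theorem IsSmoothCurve.comp {c : ℝ → V} (hc : IsSmoothCurve c) {φ : ℝ → ℝ}
    (hφ : ContDiff ℝ ∞ φ) : IsSmoothCurve fun t => c (φ t) := by
  simpa using hc.smul_comp (a := fun _ => 1) contDiff_const hφ

end Curves

/-- The scalar case of Boman's theorem. -/
theorem IsSmoothMap.contDiff {X : Type*} [NormedAddCommGroup X] [NormedSpace ℝ X]
    [FiniteDimensional ℝ X] {f : X → ℝ} (hf : IsSmoothMap f) : ContDiff ℝ ∞ f := by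
  -- The Fourier argument behind Boman's theorem needs complex values, hence the detour through `ℂ`.
  have h : ContDiffOn ℝ ∞ (fun x => (f x : ℂ)) Set.univ :=
    contDiffOn_of_comp_curve isOpen_univ fun c hc _ =>
      Complex.ofRealCLM.contDiff.comp
        (isSmoothCurve_iff_contDiff.1 (hf c (isSmoothCurve_iff_contDiff.2 hc)))
  exact Complex.reCLM.contDiff.comp (contDiffOn_univ.1 h)

end UnitaryMoment

/-! ## Partial derivatives of functions on `ℝ × E` -/

section Partial

variable {E F : Type*} [NormedAddCommGroup E] [NormedSpace ℝ E] [NormedAddCommGroup F]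
  [NormedSpace ℝ F]

theorem ContDiffOn.fderiv_apply_const {X : Type*} [NormedAddCommGroup X] [NormedSpace ℝ X]
    {f : X → F} {Ω : Set X} (hf : ContDiffOn ℝ ∞ f Ω) (hΩ : IsOpen Ω) (v : X) :
    ContDiffOn ℝ ∞ (fun p => fderiv ℝ f p v) Ω :=
  (hf.fderiv_of_isOpen hΩ le_rfl).clm_apply contDiffOn_const

theorem ContDiffOn.hasFDerivAt_of_isOpen {X : Type*} [NormedAddCommGroup X] [NormedSpace ℝ X]
    {f : X → F} {Ω : Set X} (hf : ContDiffOn ℝ ∞ f Ω) (hΩ : IsOpen Ω) {p : X} (hp : p ∈ Ω) :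
    HasFDerivAt f (fderiv ℝ f p) p :=
  ((hf.contDiffAt (hΩ.mem_nhds hp)).differentiableAt (by simp)).hasFDerivAt

theorem ContDiffOn.hasDerivAt_fst {f : ℝ × E → F} {Ω : Set (ℝ × E)} (hf : ContDiffOn ℝ ∞ f Ω)
    (hΩ : IsOpen Ω) {t : ℝ} {y : E} (hp : (t, y) ∈ Ω) :
    HasDerivAt (fun s => f (s, y)) (fderiv ℝ f (t, y) (1, 0)) t := by
  have h := (hf.hasFDerivAt_of_isOpen hΩ hp).comp_hasDerivAt t
    ((hasDerivAt_id t).prodMk (hasDerivAt_const t y))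
  exact h

theorem ContDiffOn.fderiv_snd {f : ℝ × E → F} {Ω : Set (ℝ × E)} (hf : ContDiffOn ℝ ∞ f Ω)
    (hΩ : IsOpen Ω) {t : ℝ} {y : E} (hp : (t, y) ∈ Ω) :
    fderiv ℝ (fun z => f (t, z)) y = (fderiv ℝ f (t, y)).comp (ContinuousLinearMap.inr ℝ ℝ E) :=
  ((hf.hasFDerivAt_of_isOpen hΩ hp).comp y (hasFDerivAt_prodMk_right t y)).fderiv

/-- The symmetry of the second derivative lets `∂ₜ` pass through one derivative in `y`. The isometry
`I` stands for the currying that occurs in `iteratedFDeriv`, so that this is the induction step of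
`ContDiffOn.iteratedFDeriv_snd`. -/
theorem ContDiffOn.isometry_fderiv_snd {M N : Type*} [NormedAddCommGroup M] [NormedSpace ℝ M]
    [NormedAddCommGroup N] [NormedSpace ℝ N] (I : (E →L[ℝ] M) ≃ₗᵢ[ℝ] N) {m : ℝ × E → M}
    {Ω : Set (ℝ × E)} (hm : ContDiffOn ℝ ∞ m Ω) (hΩ : IsOpen Ω) :
    ContDiffOn ℝ ∞ (fun p : ℝ × E => I (fderiv ℝ (fun z => m (p.1, z)) p.2)) Ω ∧
    ∀ p ∈ Ω, fderiv ℝ (fun p : ℝ × E => I (fderiv ℝ (fun z => m (p.1, z)) p.2)) p (1, 0)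
      = I (fderiv ℝ (fun z => fderiv ℝ m (p.1, z) (1, 0)) p.2) := by
  let J : (ℝ × E →L[ℝ] M) →L[ℝ] E →L[ℝ] M :=
    (ContinuousLinearMap.compL ℝ E (ℝ × E) M).flip (ContinuousLinearMap.inr ℝ ℝ E)
  have heq : Set.EqOn (fun p : ℝ × E => I (fderiv ℝ (fun z => m (p.1, z)) p.2))
      (fun p => I (J (fderiv ℝ m p))) Ω := by
    rintro ⟨t, y⟩ hp
    exact congrArg I (hm.fderiv_snd hΩ hp)
  have hm1 : ContDiffOn ℝ ∞ (fderiv ℝ m) Ω := hm.fderiv_of_isOpen hΩ le_rfl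
  refine ⟨(I.contDiff.comp_contDiffOn (J.contDiff.comp_contDiffOn hm1)).congr heq, ?_⟩
  rintro ⟨t, y⟩ hp
  have hm1d := hm1.hasFDerivAt_of_isOpen hΩ hp
  have hId : HasFDerivAt (fun p => I (J (fderiv ℝ m p)))
      ((I : (E →L[ℝ] M) →L[ℝ] N).comp (J.comp (fderiv ℝ (fderiv ℝ m) (t, y)))) (t, y) :=
    I.comp_hasFDerivAt_iff.2 (J.hasFDerivAt.comp (t, y) hm1d)
  rw [(heq.eventuallyEq_of_mem (hΩ.mem_nhds hp)).fderiv_eq, hId.fderiv,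
    (hm.fderiv_apply_const hΩ (1, 0)).fderiv_snd hΩ hp]
  refine congrArg I ?_
  ext v : 1
  have h3 : fderiv ℝ (fun p => fderiv ℝ m p (1, 0)) (t, y)
      = (fderiv ℝ (fderiv ℝ m) (t, y)).flip (1, 0) := by
    have := hm1d.clm_apply (hasFDerivAt_const ((1 : ℝ), (0 : E)) (t, y))
    rw [this.fderiv]
    simp
  rw [h3]
  exact (hm.contDiffAt (hΩ.mem_nhds hp)).isSymmSndFDerivAt
    (by simpa using WithTop.coe_le_coe.2 (le_top (a := (2 : ℕ∞)))) _ _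

theorem ContDiffOn.iteratedFDeriv_snd {f : ℝ × E → F} {U : Set E} (hU : IsOpen U)
    (hf : ContDiffOn ℝ ∞ f (Set.univ ×ˢ U)) (k : ℕ) :
    ContDiffOn ℝ ∞ (fun p : ℝ × E => iteratedFDeriv ℝ k (fun y => f (p.1, y)) p.2)
      (Set.univ ×ˢ U) ∧
    ∀ t, ∀ y ∈ U, fderiv ℝ (fun p : ℝ × E => iteratedFDeriv ℝ k (fun y => f (p.1, y)) p.2)
      (t, y) (1, 0) = iteratedFDeriv ℝ k (fun y => fderiv ℝ f (t, y) (1, 0)) y := by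
  have hΩ : IsOpen ((Set.univ : Set ℝ) ×ˢ U) := isOpen_univ.prod hU
  induction k with
  | zero =>
    let I := (continuousMultilinearCurryFin0 ℝ E F).symm.toContinuousLinearEquiv
    have h0 : (fun p : ℝ × E => iteratedFDeriv ℝ 0 (fun y => f (p.1, y)) p.2) = I ∘ f := by
      ext p
      simp [I]
    rw [h0]
    refine ⟨I.contDiff.comp_contDiffOn hf, fun t y hy => ?_⟩
    rw [(I.hasFDerivAt.comp (t, y) (hf.hasFDerivAt_of_isOpen hΩ ⟨trivial, hy⟩)).fderiv]
    ext m
    simp [I]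
  | succ k ih =>
    obtain ⟨hm, hd⟩ := ih
    have h := hm.isometry_fderiv_snd
      (continuousMultilinearCurryLeftEquiv ℝ (fun _ : Fin (k + 1) => E) F).symm hΩ
    refine ⟨h.1, fun t y hy => (h.2 (t, y) ⟨trivial, hy⟩).trans ?_⟩
    have hev : iteratedFDeriv ℝ k (fun y => fderiv ℝ f (t, y) (1, 0)) =ᶠ[𝓝 y]
        fun z => fderiv ℝ (fun p : ℝ × E => iteratedFDeriv ℝ k (fun y => f (p.1, y)) p.2)
          (t, z) (1, 0) := by
      filter_upwards [hU.mem_nhds hy] with z hz using (hd t z hz).symm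
    rw [iteratedFDeriv_succ_eq_comp_left, Function.comp, hev.fderiv_eq]

end Partial

/-! ### Orbit maps in charts and jointly smooth curves -/

namespace UnitaryMoment.SmoothVectors

section Orbit

variable {E : Type*} [NormedAddCommGroup E] [NormedSpace ℝ E]
  {G : Type*} [Group G] [TopologicalSpace G] [ChartedSpace E G] [IsManifold 𝓘(ℝ, E) ∞ G]
  {H : Type*} [NormedAddCommGroup H] [InnerProductSpace ℂ H] [CompleteSpace H]
  (ρ : G →* unitary (H →L[ℂ] H))

/-- The mapping `H_∞ → H`, `x ↦ ρ(g)x`. -/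
noncomputable def orbitCLM (g : G) : SmoothVectors E ρ →L[ℝ] H :=
  ((ρ g : H →L[ℂ] H).restrictScalars ℝ).comp ⟨incl ρ, continuous_incl ρ⟩

theorem orbitCLM_apply (g : G) (x : SmoothVectors E ρ) :
    orbitCLM ρ g x = (ρ g : H →L[ℂ] H) (incl ρ x) := rfl

theorem norm_orbitCLM (g : G) (x : SmoothVectors E ρ) : ‖orbitCLM ρ g x‖ = ‖incl ρ x‖ :=
  ContinuousLinearMap.norm_map_of_mem_unitary (ρ g).2 _

/-- The mapping `g ↦ ρ(g)x` in the chart `φ`. -/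
noncomputable def chartOrbit (φ : OpenPartialHomeomorph G E) (x : SmoothVectors E ρ) (y : E) : H :=
  orbitCLM ρ (φ.symm y) x

theorem contDiffOn_chartOrbit {φ : OpenPartialHomeomorph G E} (hφ : φ ∈ atlas E G)
    (x : SmoothVectors E ρ) : ContDiffOn ℝ ∞ (chartOrbit ρ φ x) φ.target := fun y hy =>
  (contDiffAt_chart_symm (orbitMap ρ x) ⟨⟨⟨φ, hφ⟩, {y}, isCompact_singleton,
    Set.singleton_subset_iff.2 hy⟩, 0⟩ rfl).contDiffWithinAt

theorem seminorm_apply (i : SeminormIndex E G) (x : SmoothVectors E ρ) :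
    (cInftySeminormFamily E G H).comp (orbitMap ρ) i x
      = ⨆ y : i.1.2.1, ‖iteratedFDeriv ℝ i.2 (chartOrbit ρ i.1.1.1 x) y‖ := rfl

theorem norm_iteratedFDeriv_le_seminorm (i : SeminormIndex E G) (x : SmoothVectors E ρ) {y : E}
    (hy : y ∈ i.1.2.1) : ‖iteratedFDeriv ℝ i.2 (chartOrbit ρ i.1.1.1 x) y‖
      ≤ (cInftySeminormFamily E G H).comp (orbitMap ρ) i x :=
  le_ciSup (bddAbove_iteratedFDeriv (orbitMap ρ x) i) ⟨y, hy⟩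

theorem seminorm_le (i : SeminormIndex E G) (x : SmoothVectors E ρ) {C : ℝ} (hC : 0 ≤ C)
    (h : ∀ y ∈ i.1.2.1, ‖iteratedFDeriv ℝ i.2 (chartOrbit ρ i.1.1.1 x) y‖ ≤ C) :
    (cInftySeminormFamily E G H).comp (orbitMap ρ) i x ≤ C := by
  rw [seminorm_apply]
  exact Real.iSup_le (fun y => h y.1 y.2) hC

theorem tendsto_of_chartOrbit {ι : Type*} {l : Filter ι} {u : ι → SmoothVectors E ρ}
    {x : SmoothVectors E ρ} (h : ∀ φ ∈ atlas E G, ∀ K ⊆ φ.target, IsCompact K → ∀ k : ℕ, ∀ ε > 0,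
      ∀ᶠ i in l, ∀ y ∈ K, ‖iteratedFDeriv ℝ k (chartOrbit ρ φ (u i - x)) y‖ ≤ ε) :
    Tendsto u l (𝓝 x) := by
  rw [(withSeminorms ρ).tendsto_nhds]
  intro i ε hε
  filter_upwards [h i.1.1.1 i.1.1.2 i.1.2.1 i.1.2.2.2 i.1.2.2.1 i.2 (ε / 2) (half_pos hε)]
    with j hj
  have h1 := seminorm_le ρ i (u j - x) (half_pos hε).le hj
  exact lt_of_le_of_lt h1 (half_lt_self hε)

/-- The curve `c` corresponds to a smooth mapping `(t, g) ↦ ρ(g)c(t)`. -/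
def IsJointlySmooth (c : ℝ → SmoothVectors E ρ) : Prop :=
  ∀ φ ∈ atlas E G, ContDiffOn ℝ ∞ (fun p : ℝ × E => chartOrbit ρ φ (c p.1) p.2)
    (Set.univ ×ˢ φ.target)

theorem iteratedFDeriv_chartOrbit_sub {φ : OpenPartialHomeomorph G E} (hφ : φ ∈ atlas E G)
    (k : ℕ) (x z : SmoothVectors E ρ) {y : E} (hy : y ∈ φ.target) :
    iteratedFDeriv ℝ k (chartOrbit ρ φ (x - z)) y
      = iteratedFDeriv ℝ k (chartOrbit ρ φ x) y - iteratedFDeriv ℝ k (chartOrbit ρ φ z) y := by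
  have hle : ((k : ℕ) : WithTop ℕ∞) ≤ ∞ := by exact_mod_cast le_top
  have hsm : ∀ w, ContDiffAt ℝ k (chartOrbit ρ φ w) y := fun w =>
    ((contDiffOn_chartOrbit ρ hφ w).contDiffAt (φ.open_target.mem_nhds hy)).of_le hle
  have : chartOrbit ρ φ (x - z) = chartOrbit ρ φ x - chartOrbit ρ φ z := by
    ext y
    simp [chartOrbit]
  rw [this, iteratedFDeriv_sub_apply (hsm x) (hsm z)]

theorem iteratedFDeriv_chartOrbit_smul {φ : OpenPartialHomeomorph G E} (hφ : φ ∈ atlas E G)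
    (k : ℕ) (r : ℝ) (x : SmoothVectors E ρ) {y : E} (hy : y ∈ φ.target) :
    iteratedFDeriv ℝ k (chartOrbit ρ φ (r • x)) y
      = r • iteratedFDeriv ℝ k (chartOrbit ρ φ x) y := by
  have hle : ((k : ℕ) : WithTop ℕ∞) ≤ ∞ := by exact_mod_cast le_top
  have : chartOrbit ρ φ (r • x) = r • chartOrbit ρ φ x := by
    ext y
    simp [chartOrbit]
  rw [this, iteratedFDeriv_const_smul_apply
    (((contDiffOn_chartOrbit ρ hφ x).contDiffAt (φ.open_target.mem_nhds hy)).of_le hle)]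

variable {ρ}

/-- Joint continuity of the derivatives in `y` gives uniformity over the compact set `K` by the tube
lemma; this is convergence in the topology of `H_∞`. -/
theorem IsJointlySmooth.eventually_norm_sub_le {c : ℝ → SmoothVectors E ρ}
    (hc : IsJointlySmooth ρ c) (t : ℝ) {φ : OpenPartialHomeomorph G E} (hφ : φ ∈ atlas E G)
    {K : Set E} (hKφ : K ⊆ φ.target) (hK : IsCompact K) (k : ℕ) {ε : ℝ} (hε : 0 < ε) :
    ∀ᶠ s in 𝓝 t, ∀ y ∈ K, ‖iteratedFDeriv ℝ k (chartOrbit ρ φ (c s)) y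
      - iteratedFDeriv ℝ k (chartOrbit ρ φ (c t)) y‖ ≤ ε := by
  refine hK.eventually_forall_of_forall_eventually
    (P := fun s y => ‖iteratedFDeriv ℝ k (chartOrbit ρ φ (c s)) y
      - iteratedFDeriv ℝ k (chartOrbit ρ φ (c t)) y‖ ≤ ε) fun y hy => ?_
  have hΩ : IsOpen ((Set.univ : Set ℝ) ×ˢ φ.target) := isOpen_univ.prod φ.open_target
  have hm := ((hc φ hφ).iteratedFDeriv_snd φ.open_target k).1.continuousOn
  have hcont : ContinuousAt
      (fun p : ℝ × E => iteratedFDeriv ℝ k (chartOrbit ρ φ (c p.1)) p.2) (t, y) :=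
    hm.continuousAt (hΩ.mem_nhds ⟨trivial, hKφ hy⟩)
  have h2 : ContinuousAt (fun p : ℝ × E => iteratedFDeriv ℝ k (chartOrbit ρ φ (c t)) p.2)
      (t, y) :=
    hcont.comp (f := fun p : ℝ × E => (t, p.2)) (x := (t, y)) (by fun_prop)
  have h3 := (hcont.sub h2).norm
  have h4 := h3.eventually (Iio_mem_nhds (show _ < ε by simpa using hε))
  filter_upwards [h4] with p hp
  exact le_of_lt hp

theorem IsJointlySmooth.continuous {c : ℝ → SmoothVectors E ρ} (hc : IsJointlySmooth ρ c) :
    Continuous c := by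
  refine continuous_iff_continuousAt.2 fun t => tendsto_of_chartOrbit ρ ?_
  intro φ hφ K hKφ hK k ε hε
  filter_upwards [hc.eventually_norm_sub_le t hφ hKφ hK k hε] with s hs y hy
  rw [iteratedFDeriv_chartOrbit_sub ρ hφ k _ _ (hKφ hy)]
  exact hs y hy

end Orbit

end UnitaryMoment.SmoothVectors

/-! ### The exponential law for curves of smooth vectors -/

namespace UnitaryMoment.SmoothVectors

section Exponential

variable {E : Type*} [NormedAddCommGroup E] [NormedSpace ℝ E]
  {G : Type*} [Group G] [TopologicalSpace G] [ChartedSpace E G] [IsManifold 𝓘(ℝ, E) ∞ G]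
  {H : Type*} [NormedAddCommGroup H] [InnerProductSpace ℂ H] [CompleteSpace H]
  {ρ : G →* unitary (H →L[ℂ] H)}

/-- Let `v` be the derivative of `c` as a curve in `H`, read off at `g = 1`. As `ρ(g)` is continuous
and linear, `ρ(g)v(t)` is the partial derivative in `t` of `ρ(g)c(t)`. That is smooth in `g`, so
`v(t)` is a smooth vector. -/
theorem IsJointlySmooth.exists_hasDerivAt {c : ℝ → SmoothVectors E ρ}
    (hc : IsJointlySmooth ρ c) : ∃ c' : ℝ → SmoothVectors E ρ,
      ∀ φ ∈ atlas E G, ∀ t, ∀ y ∈ φ.target, chartOrbit ρ φ (c' t) y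
        = fderiv ℝ (fun p : ℝ × E => chartOrbit ρ φ (c p.1) p.2) (t, y) (1, 0) := by
  have hΩ : ∀ φ : OpenPartialHomeomorph G E, IsOpen ((Set.univ : Set ℝ) ×ˢ φ.target) :=
    fun φ => isOpen_univ.prod φ.open_target
  have hder : ∀ φ ∈ atlas E G, ∀ t, ∀ y ∈ φ.target,
      HasDerivAt (fun s => chartOrbit ρ φ (c s) y)
        (fderiv ℝ (fun p : ℝ × E => chartOrbit ρ φ (c p.1) p.2) (t, y) (1, 0)) t :=
    fun φ hφ t y hy => (hc φ hφ).hasDerivAt_fst (hΩ φ) ⟨trivial, hy⟩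
  have hv : ∃ v : ℝ → H, ∀ t, HasDerivAt (fun s => incl ρ (c s)) (v t) t := by
    refine ⟨fun t => fderiv ℝ (fun p : ℝ × E => chartOrbit ρ (chartAt E (1 : G)) (c p.1) p.2)
      (t, chartAt E (1 : G) 1) (1, 0), fun t => ?_⟩
    have h := hder (chartAt E (1 : G)) (chart_mem_atlas E 1) t (chartAt E (1 : G) 1)
      (mem_chart_target E 1)
    simp only [chartOrbit, (chartAt E (1 : G)).left_inv (mem_chart_source E (1 : G)),
      orbitCLM_apply, map_one, OneMemClass.coe_one, one_apply_eq_self] at h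
    exact h
  obtain ⟨v, hv⟩ := hv
  have heq : ∀ φ ∈ atlas E G, ∀ t, ∀ y ∈ φ.target, (ρ (φ.symm y) : H →L[ℂ] H) (v t)
      = fderiv ℝ (fun p : ℝ × E => chartOrbit ρ φ (c p.1) p.2) (t, y) (1, 0) := by
    intro φ hφ t y hy
    refine HasDerivAt.unique ?_ (hder φ hφ t y hy)
    exact ((ρ (φ.symm y) : H →L[ℂ] H).restrictScalars ℝ).hasFDerivAt.comp_hasDerivAt t (hv t)
  have hmem : ∀ t, v t ∈ smoothVectorSubspace E ρ := by
    intro t g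
    set φ := chartAt E g
    have hφ : φ ∈ atlas E G := chart_mem_atlas E g
    have h1 : ContDiffOn ℝ ∞
        (fun y => fderiv ℝ (fun p : ℝ × E => chartOrbit ρ φ (c p.1) p.2) (t, y) (1, 0))
        φ.target :=
      ((hc φ hφ).fderiv_apply_const (hΩ φ) (1, 0)).comp
        (contDiff_const.prodMk contDiff_id).contDiffOn fun y hy => ⟨trivial, hy⟩
    have h2 : ContMDiffOn 𝓘(ℝ, E) 𝓘(ℝ, E) ∞ φ φ.source :=
      contMDiffOn_of_mem_maximalAtlas (IsManifold.subset_maximalAtlas hφ)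
    have h3 := h1.contMDiffOn.comp h2 fun x hx => φ.map_source hx
    refine (h3.congr fun x hx => ?_).contMDiffAt
      (φ.open_source.mem_nhds (mem_chart_source E g))
    rw [Function.comp, ← heq φ hφ t _ (φ.map_source hx), φ.left_inv hx]
  exact ⟨fun t => (⟨v t, hmem t⟩ : smoothVectorSubspace E ρ), heq⟩

theorem IsJointlySmooth.exists_deriv {c : ℝ → SmoothVectors E ρ} (hc : IsJointlySmooth ρ c) :
    ∃ c', IsJointlySmooth ρ c' ∧ ∀ t, HasCurveDerivAt c (c' t) t := by
  obtain ⟨c', heq⟩ := hc.exists_hasDerivAt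
  have hΩ : ∀ φ : OpenPartialHomeomorph G E, IsOpen ((Set.univ : Set ℝ) ×ˢ φ.target) :=
    fun φ => isOpen_univ.prod φ.open_target
  have hc' : IsJointlySmooth ρ c' := fun φ hφ =>
    ((hc φ hφ).fderiv_apply_const (hΩ φ) (1, 0)).congr fun p hp => heq φ hφ p.1 p.2 hp.2
  refine ⟨c', hc', fun t => tendsto_of_chartOrbit ρ ?_⟩
  intro φ hφ K hKφ hK k ε hε
  have hder : ∀ s, ∀ y ∈ K, HasDerivAt (fun s => iteratedFDeriv ℝ k (chartOrbit ρ φ (c s)) y)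
      (iteratedFDeriv ℝ k (chartOrbit ρ φ (c' s)) y) s := by
    intro s y hy
    obtain ⟨h1, h2⟩ := (hc φ hφ).iteratedFDeriv_snd φ.open_target k
    have h3 := h1.hasDerivAt_fst (hΩ φ) (t := s) (y := y) ⟨trivial, hKφ hy⟩
    rw [h2 s y (hKφ hy)] at h3
    have hev : chartOrbit ρ φ (c' s) =ᶠ[𝓝 y] fun y =>
        fderiv ℝ (fun p : ℝ × E => chartOrbit ρ φ (c p.1) p.2) (s, y) (1, 0) := by
      filter_upwards [φ.open_target.mem_nhds (hKφ hy)] with z hz using heq φ hφ s z hz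
    rw [(hev.iteratedFDeriv ℝ k).eq_of_nhds]
    exact h3
  obtain ⟨δ, hδ, hball⟩ := Metric.eventually_nhds_iff_ball.1
    (hc'.eventually_norm_sub_le t hφ hKφ hK k hε)
  filter_upwards [nhdsWithin_le_nhds (Metric.ball_mem_nhds (0 : ℝ) hδ), self_mem_nhdsWithin]
    with s hs hs0 y hy
  have hs0' : s ≠ 0 := hs0
  have hyφ := hKφ hy
  rw [iteratedFDeriv_chartOrbit_sub ρ hφ k _ _ hyφ, iteratedFDeriv_chartOrbit_smul ρ hφ k _ _ hyφ,
    iteratedFDeriv_chartOrbit_sub ρ hφ k _ _ hyφ]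
  -- The mean value inequality, after subtracting the linear part with slope at `t`, bounds the
  -- error of the difference quotient by the oscillation of the derivative, which is at most `ε`
  -- uniformly in `y ∈ K`.
  have hmv := (convex_ball t δ).norm_image_sub_le_of_norm_hasDerivWithin_le (C := ε)
    (f := fun σ => iteratedFDeriv ℝ k (chartOrbit ρ φ (c σ)) y
      - σ • iteratedFDeriv ℝ k (chartOrbit ρ φ (c' t)) y)
    (f' := fun σ => iteratedFDeriv ℝ k (chartOrbit ρ φ (c' σ)) y
      - (1 : ℝ) • iteratedFDeriv ℝ k (chartOrbit ρ φ (c' t)) y)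
    (fun σ _ => ((hder σ y hy).sub ((hasDerivAt_id σ).smul_const _)).hasDerivWithinAt)
    (fun σ hσ => by simpa using hball σ hσ y hy)
    (Metric.mem_ball_self hδ) (y := t + s) (by simpa using hs)
  have hrw : s⁻¹ • (iteratedFDeriv ℝ k (chartOrbit ρ φ (c (t + s))) y
      - iteratedFDeriv ℝ k (chartOrbit ρ φ (c t)) y)
      - iteratedFDeriv ℝ k (chartOrbit ρ φ (c' t)) y
      = s⁻¹ • (iteratedFDeriv ℝ k (chartOrbit ρ φ (c (t + s))) y
        - (t + s) • iteratedFDeriv ℝ k (chartOrbit ρ φ (c' t)) y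
        - (iteratedFDeriv ℝ k (chartOrbit ρ φ (c t)) y
        - t • iteratedFDeriv ℝ k (chartOrbit ρ φ (c' t)) y)) := by
    have : iteratedFDeriv ℝ k (chartOrbit ρ φ (c' t)) y
        = (s⁻¹ * s) • iteratedFDeriv ℝ k (chartOrbit ρ φ (c' t)) y := by
      rw [inv_mul_cancel₀ hs0', one_smul]
    nth_rw 1 [this]
    module
  rw [hrw, norm_smul, norm_inv]
  rw [add_sub_cancel_left] at hmv
  have hpos : 0 < ‖s‖ := norm_pos_iff.2 hs0'
  rw [inv_mul_le_iff₀ hpos, mul_comm]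
  exact hmv

theorem IsJointlySmooth.isSmoothCurve {c : ℝ → SmoothVectors E ρ} (hc : IsJointlySmooth ρ c) :
    IsSmoothCurve c :=
  IsSmoothCurve.of_forall_exists_deriv (fun _ hc => ⟨hc.continuous, hc.exists_deriv⟩) hc

theorem iteratedDeriv_eq_of_hasDerivAt {F : Type*} [NormedAddCommGroup F] [NormedSpace ℝ F]
    {D : ℕ → ℝ → F} (hD : ∀ n t, HasDerivAt (D n) (D (n + 1) t) t) (n : ℕ) :
    iteratedDeriv n (D 0) = D n := by
  induction n with
  | zero => simp
  | succ n ih => rw [iteratedDeriv_succ, ih]; exact funext fun t => (hD n t).deriv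

/-- The smoothness criterion asks only for pure derivatives in `t` and pure derivatives in `y`. The
former are `ρ(g)D p t`, the latter are those of a single orbit map. -/
theorem _root_.UnitaryMoment.IsSmoothCurve.isJointlySmooth [FiniteDimensional ℝ E]
    {c : ℝ → SmoothVectors E ρ} (hc : IsSmoothCurve c) : IsJointlySmooth ρ c := by
  intro φ hφ
  have hcont := hc.continuous
  have hsm : ∀ g, ContDiff ℝ ∞ fun t => orbitCLM ρ g (c t) := fun g =>
    isSmoothCurve_iff_contDiff.1 (hc.clm (orbitCLM ρ g))
  obtain ⟨D, rfl, hD⟩ := hc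
  have hiter : ∀ p g t, iteratedDeriv p (fun s => orbitCLM ρ g (D 0 s)) t
      = orbitCLM ρ g (D p t) := fun p g t =>
    congrFun (iteratedDeriv_eq_of_hasDerivAt (D := fun n s => orbitCLM ρ g (D n s))
      (fun n t => hasCurveDerivAt_iff_hasDerivAt.1 (((hD n).2 t).clm (orbitCLM ρ g))) p) t
  have hΩ : IsOpen ((Set.univ : Set ℝ) ×ˢ φ.target) := isOpen_univ.prod φ.open_target
  have hchart := contDiffOn_chartOrbit ρ hφ
  refine contDiffOn_of_locally_bounded_lineDeriv
    ((Module.Basis.singleton Unit ℝ).prod (Module.finBasis ℝ E)) hΩ ?_ ?_ ?_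
  · rintro ⟨t, y⟩ ⟨-, hy⟩
    refine ContinuousAt.continuousWithinAt ?_
    -- Since `ρ(g)` is isometric, the change in `t` is small uniformly in `g`; this upgrades
    -- separate to joint continuity.
    have h1 : Tendsto (fun p : ℝ × E => chartOrbit ρ φ (D 0 p.1 - D 0 t) p.2) (𝓝 (t, y))
        (𝓝 0) := by
      rw [tendsto_zero_iff_norm_tendsto_zero]
      simp only [chartOrbit, norm_orbitCLM]
      have : Continuous fun p : ℝ × E => ‖incl ρ (D 0 p.1 - D 0 t)‖ :=
        ((continuous_incl ρ).comp ((hcont.comp continuous_fst).sub continuous_const)).norm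
      simpa using this.tendsto (t, y)
    have h2 : Tendsto (fun p : ℝ × E => chartOrbit ρ φ (D 0 t) p.2) (𝓝 (t, y))
        (𝓝 (chartOrbit ρ φ (D 0 t) y)) :=
      (((hchart (D 0 t)).continuousOn.continuousAt (φ.open_target.mem_nhds hy)).comp
        (f := fun p : ℝ × E => p.2) (x := (t, y)) continuousAt_snd)
    have h3 := h1.add h2
    rw [zero_add] at h3
    refine h3.congr fun p => ?_
    simp [chartOrbit]
  · rintro ⟨t, y⟩ ⟨-, hy⟩ (i | i)
    · simp only [Module.Basis.prod_apply, Sum.elim_inl, Function.comp, LinearMap.inl_apply,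
        Module.Basis.singleton_apply, Prod.smul_mk, Prod.mk_add_mk, smul_zero, add_zero,
        smul_eq_mul, mul_one]
      exact ((hsm (φ.symm y)).comp (contDiff_const.add contDiff_id)).contDiffAt
    · simp only [Module.Basis.prod_apply, Sum.elim_inr, Function.comp, LinearMap.inr_apply,
        Prod.smul_mk, Prod.mk_add_mk, smul_zero, add_zero]
      have hline : ContDiffAt ℝ ∞ (fun s : ℝ => y + s • Module.finBasis ℝ E i) 0 :=
        (contDiff_const.add (contDiff_id.smul contDiff_const)).contDiffAt
      refine ContDiffAt.comp (g := chartOrbit ρ φ (D 0 t)) (0 : ℝ) ?_ hline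
      simpa using (hchart (D 0 t)).contDiffAt (φ.open_target.mem_nhds hy)
  · rintro (i | i) p ⟨t, y⟩ ⟨-, hy⟩
    · simp only [Module.Basis.prod_apply, Sum.elim_inl, Function.comp, LinearMap.inl_apply,
        Module.Basis.singleton_apply]
      -- By unitarity the norm of the `p`-th derivative in `t` does not depend on `g`.
      have hb : Continuous fun z : ℝ × E => ‖incl ρ (D p z.1)‖ :=
        ((continuous_incl ρ).comp ((hD p).1.comp continuous_fst)).norm
      refine ⟨‖incl ρ (D p t)‖ + 1, ?_⟩
      filter_upwards [(hb.tendsto (t, y)).eventually (Iic_mem_nhds (lt_add_one _))] with z hz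
      have h1 : (fun s : ℝ => chartOrbit ρ φ (D 0 (z + s • ((1 : ℝ), (0 : E))).1)
          (z + s • ((1 : ℝ), (0 : E))).2) = fun s => orbitCLM ρ (φ.symm z.2) (D 0 (z.1 + s)) := by
        ext s
        simp [chartOrbit]
      have h2 := congrFun (iteratedDeriv_comp_const_add p
        (fun s => orbitCLM ρ (φ.symm z.2) (D 0 s)) z.1) 0
      rw [h1, h2, hiter, norm_orbitCLM, add_zero]
      exact hz
    · simp only [Module.Basis.prod_apply, Sum.elim_inr, Function.comp, LinearMap.inr_apply]
      -- On a compact neighbourhood of `y` the derivatives in `y` are bounded by a defining seminorm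
      -- of `H_∞`, which is continuous along the curve.
      obtain ⟨K, hK, hKy, hKφ⟩ := exists_compact_subset φ.open_target hy
      set j : SeminormIndex E G := ⟨⟨⟨φ, hφ⟩, K, hK, hKφ⟩, p⟩
      have hb : Continuous fun z : ℝ × E =>
          (cInftySeminormFamily E G H).comp (orbitMap ρ) j (D 0 z.1) :=
        ((withSeminorms ρ).continuous_seminorm j).comp (hcont.comp continuous_fst)
      refine ⟨((cInftySeminormFamily E G H).comp (orbitMap ρ) j (D 0 t) + 1) *
        ∏ _k : Fin p, ‖Module.finBasis ℝ E i‖, ?_⟩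
      filter_upwards [(hb.tendsto (t, y)).eventually (Iic_mem_nhds (lt_add_one _)),
        (isOpen_univ.prod isOpen_interior).mem_nhds
          (show (t, y) ∈ (Set.univ : Set ℝ) ×ˢ interior K from ⟨trivial, hKy⟩)] with z hz hzK
      have hz2 := interior_subset hzK.2
      have h1 : (fun s : ℝ => chartOrbit ρ φ (D 0 (z + s • ((0 : ℝ), Module.finBasis ℝ E i)).1)
          (z + s • ((0 : ℝ), Module.finBasis ℝ E i)).2)
          = fun s => chartOrbit ρ φ (D 0 z.1) (z.2 + s • Module.finBasis ℝ E i) := by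
        ext s
        simp
      rw [h1, iteratedDeriv_line φ.open_target (hchart _) _ _ (hKφ hz2)]
      refine (ContinuousMultilinearMap.le_opNorm _ _).trans ?_
      gcongr
      exact (norm_iteratedFDeriv_le_seminorm ρ j (D 0 z.1) hz2).trans hz

end Exponential

end UnitaryMoment.SmoothVectors

namespace UnitaryMoment

/-! ## Smoothness of directional derivatives -/

/-- The partial derivative of a smooth mapping `ℝ² → W` along an axis is a smooth curve. This
follows from completeness of `W`. -/
def HasSmoothPartialDerivs (W : Type*) [AddCommGroup W] [Module ℝ W] [TopologicalSpace W] :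
    Prop :=
  ∀ h : ℝ × ℝ → W, IsSmoothMap h → ∃ d : ℝ → W, IsSmoothCurve d ∧
    ∀ t, HasCurveDerivAt (fun s => h (s, t)) (d t) 0

theorem hasSmoothPartialDerivs_real : HasSmoothPartialDerivs ℝ := by
  intro h hh
  have hd := hh.contDiff
  refine ⟨fun t => fderiv ℝ h (0, t) (1, 0), isSmoothCurve_iff_contDiff.2 ?_, fun t => ?_⟩
  · exact ((hd.fderiv_right le_rfl).clm_apply contDiff_const).comp
      (contDiff_const.prodMk contDiff_id)
  · exact hasCurveDerivAt_iff_hasDerivAt.2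
      (hd.contDiffOn.hasDerivAt_fst isOpen_univ (Set.mem_univ _))

/-- Boman's theorem reduces this to curves `τ ↦ (a(τ), y(τ))`. There `h ∘ a` is a smooth curve, so
the exponential law makes the orbit smooth in `(τ, y)`, and one substitutes `y = y(τ)`. -/
theorem SmoothVectors.contDiffOn_chartOrbit_of_isSmoothMap
    {E : Type*} [NormedAddCommGroup E] [NormedSpace ℝ E] [FiniteDimensional ℝ E]
    {G : Type*} [Group G] [TopologicalSpace G] [ChartedSpace E G] [IsManifold 𝓘(ℝ, E) ∞ G]
    {H : Type*} [NormedAddCommGroup H] [InnerProductSpace ℂ H] [CompleteSpace H]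
    {ρ : G →* unitary (H →L[ℂ] H)} {X : Type*} [NormedAddCommGroup X] [NormedSpace ℝ X]
    [FiniteDimensional ℝ X] {h : X → SmoothVectors E ρ} (hh : IsSmoothMap h)
    {φ : OpenPartialHomeomorph G E} (hφ : φ ∈ atlas E G) :
    ContDiffOn ℝ ∞ (fun p : X × E => chartOrbit ρ φ (h p.1) p.2) (Set.univ ×ˢ φ.target) := by
  refine contDiffOn_of_comp_curve (isOpen_univ.prod φ.open_target) fun c hc hcΩ => ?_
  have h1 : IsJointlySmooth ρ fun τ => h (c τ).1 :=
    (hh _ (isSmoothCurve_iff_contDiff.2 (contDiff_fst.comp hc))).isJointlySmooth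
  exact (h1 φ hφ).comp_contDiff (contDiff_id.prodMk (contDiff_snd.comp hc))
    fun τ => ⟨trivial, (hcΩ τ).2⟩

/-- The partial derivatives exist along each horizontal line. In charts their orbits are a partial
derivative of a smooth function on an open subset of `ℝ² × E`, so they depend jointly smoothly on
`(t, y)`, and the exponential law applies in the other direction. -/
theorem SmoothVectors.hasSmoothPartialDerivs
    {E : Type*} [NormedAddCommGroup E] [NormedSpace ℝ E] [FiniteDimensional ℝ E]
    {G : Type*} [Group G] [TopologicalSpace G] [ChartedSpace E G] [IsManifold 𝓘(ℝ, E) ∞ G]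
    {H : Type*} [NormedAddCommGroup H] [InnerProductSpace ℂ H] [CompleteSpace H]
    (ρ : G →* unitary (H →L[ℂ] H)) : HasSmoothPartialDerivs (SmoothVectors E ρ) := by
  intro h hh
  have hex : ∀ t, ∃ v, HasCurveDerivAt (fun s => h (s, t)) v 0 := fun t =>
    (hh _ (isSmoothCurve_iff_contDiff.2
      (contDiff_id.prodMk (contDiff_const (c := t))))).exists_deriv 0
  choose d hd using hex
  refine ⟨d, IsJointlySmooth.isSmoothCurve fun φ hφ => ?_, hd⟩
  have hsm := contDiffOn_chartOrbit_of_isSmoothMap hh hφ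
  have hΩ : IsOpen ((Set.univ : Set (ℝ × ℝ)) ×ˢ φ.target) := isOpen_univ.prod φ.open_target
  have h1 : ContDiffOn ℝ ∞ (fun p : ℝ × E => fderiv ℝ
      (fun p : (ℝ × ℝ) × E => chartOrbit ρ φ (h p.1) p.2) ((0, p.1), p.2) ((1, 0), 0))
      (Set.univ ×ˢ φ.target) :=
    (hsm.fderiv_apply_const hΩ ((1, 0), 0)).comp
      ((contDiff_const.prodMk contDiff_fst).prodMk contDiff_snd).contDiffOn
      fun p hp => ⟨trivial, hp.2⟩
  refine h1.congr ?_
  rintro ⟨t, y⟩ ⟨-, hy⟩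
  have h2 : HasDerivAt (fun s => chartOrbit ρ φ (h (s, t)) y) (chartOrbit ρ φ (d t) y) 0 :=
    hasCurveDerivAt_iff_hasDerivAt.1 ((hd t).clm (orbitCLM ρ (φ.symm y)))
  refine h2.unique ?_
  exact (hsm.hasFDerivAt_of_isOpen hΩ (p := (((0 : ℝ), t), y)) ⟨trivial, hy⟩).comp_hasDerivAt
    (0 : ℝ) (((hasDerivAt_id (0 : ℝ)).prodMk (hasDerivAt_const (0 : ℝ) t)).prodMk
      (hasDerivAt_const (0 : ℝ) y))

section Abstract

variable {V W : Type*} [AddCommGroup V] [Module ℝ V] [TopologicalSpace V]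
  [AddCommGroup W] [Module ℝ W] [TopologicalSpace W]
  [IsTopologicalAddGroup V] [ContinuousSMul ℝ V]

theorem IsSmoothMap.hasCurveDerivAt [T2Space W] {f : V → W} (hf : IsSmoothMap f) (x v : V) :
    HasCurveDerivAt (fun t : ℝ => f (x + t • v)) (dirDeriv f x v) 0 :=
  hasCurveDerivAt_dirDeriv (hf.exists_dirDeriv x v)

theorem IsSmoothMap.dirDeriv [T2Space W] (hW : HasSmoothPartialDerivs W) {f : V → W}
    (hf : IsSmoothMap f) : IsSmoothMap fun p : V × V => dirDeriv f p.1 p.2 := by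
  intro c hc
  -- For a curve `t ↦ (x(t), v(t))` the derivative `df(x(t))v(t)` is the partial derivative at `s =
  -- 0` of `f(x(t) + s v(t))`.
  obtain ⟨d, hd, hder⟩ := hW (fun p => f ((c p.2).1 + p.1 • (c p.2).2)) fun e he => by
    have h1 : ContDiff ℝ ∞ fun t => (e t).1 := isSmoothCurve_iff_contDiff.1 he.fst
    have h2 : ContDiff ℝ ∞ fun t => (e t).2 := isSmoothCurve_iff_contDiff.1 he.snd
    exact hf _ ((hc.fst.comp h2).add (hc.snd.smul_comp h1 h2))
  have heq : (fun p : V × V => UnitaryMoment.dirDeriv f p.1 p.2) ∘ c = d :=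
    funext fun t => dirDeriv_eq (hder t)
  rwa [heq]

theorem IsSmoothMap.dirDeriv_comp [T2Space W] (hW : HasSmoothPartialDerivs W) {f : V → W}
    (hf : IsSmoothMap f) {U : Type*} [AddCommGroup U] [Module ℝ U] [TopologicalSpace U]
    {a b : U → V} (ha : IsSmoothMap a) (hb : IsSmoothMap b) :
    IsSmoothMap fun x => UnitaryMoment.dirDeriv f (a x) (b x) := by
  intro c hc
  have h := hf.dirDeriv hW (fun t => (a (c t), b (c t))) ((ha c hc).prodMk (hb c hc))
  exact h

theorem IsSmoothMap.iterDeriv [T2Space W] (hW : HasSmoothPartialDerivs W) {f : V → W}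
    (hf : IsSmoothMap f) (n : ℕ) :
    IsSmoothMap fun p : V × (Fin n → V) => iterDeriv f n p.1 p.2 := by
  induction n with
  | zero => exact fun c hc => hf _ hc.fst
  | succ n ih =>
    -- Treating the earlier directions as variables that are not moved (second component `0`) makes
    -- the next derivative a directional derivative of the `n`-th one on the product space.
    have h : (fun p : V × (Fin (n + 1) → V) => UnitaryMoment.iterDeriv f (n + 1) p.1 p.2)
        = fun p => UnitaryMoment.dirDeriv
          (fun q : V × (Fin n → V) => UnitaryMoment.iterDeriv f n q.1 q.2)
          (p.1, Fin.tail p.2) (p.2 0, 0) := by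
      ext p
      simp [UnitaryMoment.iterDeriv, UnitaryMoment.dirDeriv]
    rw [h]
    refine ih.dirDeriv_comp hW (fun c hc => hc.fst.prodMk ?_)
      fun c hc => (hc.snd.apply 0).prodMk (isSmoothCurve_const 0)
    exact IsSmoothCurve.pi fun i => hc.snd.apply i.succ

theorem IsSmoothMap.iterDeriv_apply [T2Space W] (hW : HasSmoothPartialDerivs W) {f : V → W}
    (hf : IsSmoothMap f) (n : ℕ) (y : Fin n → V) :
    IsSmoothMap fun x => UnitaryMoment.iterDeriv f n x y :=
  (hf.iterDeriv hW n).comp (isSmoothMap_id.prodMk (isSmoothMap_const y))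

/-- Restricted to the plane spanned by `u` and `v` through `x`, `f` is smooth in the classical sense
by Boman's theorem, so Schwarz's theorem applies. -/
theorem IsSmoothMap.dirDeriv_comm {f : V → ℝ} (hf : IsSmoothMap f) (x u v : V) :
    UnitaryMoment.dirDeriv (fun x' => UnitaryMoment.dirDeriv f x' u) x v
      = UnitaryMoment.dirDeriv (fun x' => UnitaryMoment.dirDeriv f x' v) x u := by
  let g : ℝ × ℝ → ℝ := fun p => f (x + p.1 • u + p.2 • v)
  have hg : ContDiff ℝ ∞ g := by
    refine IsSmoothMap.contDiff fun e he => hf _ (((isSmoothCurve_const x).add ?_).add ?_)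
    · exact (isSmoothCurve_const u).smul_comp (isSmoothCurve_iff_contDiff.1 he.fst)
        contDiff_id
    · exact (isSmoothCurve_const v).smul_comp (isSmoothCurve_iff_contDiff.1 he.snd)
        contDiff_id
  have hgd : ∀ p, HasFDerivAt g (fderiv ℝ g p) p := fun p =>
    (hg.differentiable (by simp) p).hasFDerivAt
  have hg1 : HasFDerivAt (fderiv ℝ g) (fderiv ℝ (fderiv ℝ g) (0, 0)) (0, 0) :=
    ((hg.fderiv_right (m := ∞) le_rfl).differentiable (by simp) _).hasFDerivAt
  have hu : ∀ t : ℝ, UnitaryMoment.dirDeriv f (x + t • v) u = fderiv ℝ g (0, t) (1, 0) := by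
    intro t
    refine dirDeriv_eq (hasCurveDerivAt_iff_hasDerivAt.2 ?_)
    have := (hgd (0, t)).comp_hasDerivAt (0 : ℝ)
      ((hasDerivAt_id (0 : ℝ)).prodMk (hasDerivAt_const (0 : ℝ) t))
    refine this.congr_of_eventuallyEq (Eventually.of_forall fun s => ?_)
    simp only [g, Function.comp, id]
    congr 1
    abel
  have hv : ∀ s : ℝ, UnitaryMoment.dirDeriv f (x + s • u) v = fderiv ℝ g (s, 0) (0, 1) := by
    intro s
    refine dirDeriv_eq (hasCurveDerivAt_iff_hasDerivAt.2 ?_)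
    exact (hgd (s, 0)).comp_hasDerivAt (0 : ℝ)
      ((hasDerivAt_const (0 : ℝ) s).prodMk (hasDerivAt_id (0 : ℝ)))
  have h1 : UnitaryMoment.dirDeriv (fun x' => UnitaryMoment.dirDeriv f x' u) x v
      = fderiv ℝ (fderiv ℝ g) (0, 0) (0, 1) (1, 0) := by
    refine dirDeriv_eq (hasCurveDerivAt_iff_hasDerivAt.2 ?_)
    simp only [hu]
    have := hg1.comp_hasDerivAt (0 : ℝ)
      ((hasDerivAt_const (0 : ℝ) (0 : ℝ)).prodMk (hasDerivAt_id (0 : ℝ)))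
    simpa using this.clm_apply (hasDerivAt_const (0 : ℝ) ((1 : ℝ), (0 : ℝ)))
  have h2 : UnitaryMoment.dirDeriv (fun x' => UnitaryMoment.dirDeriv f x' v) x u
      = fderiv ℝ (fderiv ℝ g) (0, 0) (1, 0) (0, 1) := by
    refine dirDeriv_eq (hasCurveDerivAt_iff_hasDerivAt.2 ?_)
    simp only [hv]
    have := HasFDerivAt.comp_hasDerivAt (f := fun s : ℝ => (s, (0 : ℝ))) (0 : ℝ) hg1
      ((hasDerivAt_id (0 : ℝ)).prodMk (hasDerivAt_const (0 : ℝ) (0 : ℝ)))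
    simpa using this.clm_apply (hasDerivAt_const (0 : ℝ) ((0 : ℝ), (1 : ℝ)))
  rw [h1, h2]
  exact hg.contDiffAt.isSymmSndFDerivAt
    (by simpa using WithTop.coe_le_coe.2 (le_top (a := (2 : ℕ∞)))) _ _

/-- Moves the last differentiation to the first place by repeated transposition, which brings
`dⁿ⁺¹f` down to the `n`-th derivative of `df(·)v`. -/
theorem IsSmoothMap.iterDeriv_dirDeriv {f : V → ℝ} (hf : IsSmoothMap f) (n : ℕ) (x v : V)
    (y : Fin n → V) : UnitaryMoment.iterDeriv (fun x' => UnitaryMoment.dirDeriv f x' v) n x y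
      = UnitaryMoment.dirDeriv (fun x' => UnitaryMoment.iterDeriv f n x' y) x v := by
  induction n generalizing x with
  | zero => rfl
  | succ n ih =>
    simp only [UnitaryMoment.iterDeriv, ih]
    exact (hf.iterDeriv_apply hasSmoothPartialDerivs_real n (Fin.tail y)).dirDeriv_comm x v (y 0)

theorem iterDeriv_clm [T2Space W] (hW : HasSmoothPartialDerivs W) {f : V → W}
    (hf : IsSmoothMap f) (L : W →L[ℝ] ℝ) (n : ℕ) (x : V) (y : Fin n → V) :
    iterDeriv (fun x' => L (f x')) n x y = L (iterDeriv f n x y) := by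
  induction n generalizing x with
  | zero => rfl
  | succ n ih =>
    simp only [iterDeriv, ih]
    exact dirDeriv_eq (((hf.iterDeriv_apply hW n (Fin.tail y)).hasCurveDerivAt x (y 0)).clm L)

theorem dirDeriv_smul_dir [T2Space W] [IsTopologicalAddGroup W] [ContinuousSMul ℝ W]
    {f : V → W} (hf : IsSmoothMap f) (x v : V) (r : ℝ) :
    dirDeriv f x (r • v) = r • dirDeriv f x v := by
  refine dirDeriv_eq ?_
  have h1 : HasCurveDerivAt (fun s : ℝ => s * r) r 0 :=
    hasCurveDerivAt_iff_hasDerivAt.2 (by simpa using (hasDerivAt_id (0 : ℝ)).mul_const r)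
  have h2 := HasCurveDerivAt.comp (φ := fun s : ℝ => s * r) (t := 0)
    (by simpa using hf.hasCurveDerivAt x v) h1
  simpa only [mul_smul] using h2

end Abstract

/-! ## The Poincaré lemma for `1`-forms -/

theorem hasDerivAt_intervalIntegral_param {k : ℝ × ℝ → ℝ} (hk : ContDiff ℝ ∞ k) (s : ℝ) :
    HasDerivAt (fun s => ∫ t in (0 : ℝ)..1, k (t, s))
      (∫ t in (0 : ℝ)..1, fderiv ℝ k (t, s) (0, 1)) s := by
  have hk' : Continuous fun p : ℝ × ℝ => fderiv ℝ k p (0, 1) :=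
    (hk.continuous_fderiv (by simp)).clm_apply continuous_const
  obtain ⟨C, hC⟩ := ((isCompact_Icc (a := (0 : ℝ)) (b := 1)).prod
    (isCompact_closedBall s 1)).exists_bound_of_continuousOn hk'.continuousOn
  refine (intervalIntegral.hasDerivAt_integral_of_dominated_loc_of_deriv_le
    (F := fun s t => k (t, s)) (F' := fun s t => fderiv ℝ k (t, s) (0, 1))
    (bound := fun _ => C) (Metric.ball_mem_nhds s one_pos) ?_ ?_ ?_ ?_ ?_ ?_).2
  · exact Eventually.of_forall fun s =>
      (hk.continuous.comp (by fun_prop : Continuous fun t => (t, s))).aestronglyMeasurable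
  · exact (hk.continuous.comp
      (by fun_prop : Continuous fun t => (t, s))).intervalIntegrable _ _
  · exact (hk'.comp (by fun_prop : Continuous fun t => (t, s))).aestronglyMeasurable
  · refine Eventually.of_forall fun t ht z hz => hC (t, z) ⟨?_, Metric.ball_subset_closedBall hz⟩
    rw [Set.uIoc_of_le zero_le_one] at ht
    exact ⟨ht.1.le, ht.2⟩
  · exact intervalIntegrable_const
  · refine Eventually.of_forall fun t _ z _ => ?_
    exact ((hk.differentiable (by simp) (t, z)).hasFDerivAt).comp_hasDerivAt z
      ((hasDerivAt_const z t).prodMk (hasDerivAt_id z))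

theorem isSmoothCurve_intervalIntegral_param {k : ℝ × ℝ → ℝ} (hk : ContDiff ℝ ∞ k) :
    IsSmoothCurve fun s => ∫ t in (0 : ℝ)..1, k (t, s) := by
  refine IsSmoothCurve.of_forall_exists_deriv (P := fun e => ∃ k : ℝ × ℝ → ℝ,
    ContDiff ℝ ∞ k ∧ e = fun s => ∫ t in (0 : ℝ)..1, k (t, s)) ?_ ⟨k, hk, rfl⟩
  rintro _ ⟨k, hk, rfl⟩
  have hd := hasDerivAt_intervalIntegral_param hk
  exact ⟨continuous_iff_continuousAt.2 fun s => (hd s).continuousAt, _,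
    ⟨fun p => fderiv ℝ k p (0, 1), (hk.fderiv_right le_rfl).clm_apply contDiff_const, rfl⟩,
    fun s => hasCurveDerivAt_iff_hasDerivAt.2 (hd s)⟩

section Poincare

variable {V : Type*} [AddCommGroup V] [Module ℝ V] [TopologicalSpace V]
  [IsTopologicalAddGroup V] [ContinuousSMul ℝ V]

/-- **Poincaré lemma**. -/
theorem exists_primitive_of_mem_closedOneForms {α : RawOneForm V} (hα : α ∈ closedOneForms V) :
    ∃ f : V → ℝ, IsSmoothMap f ∧ ∀ x v, dirDeriv f x v = α x v := by
  obtain ⟨hs, hcl⟩ := hα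
  have hk : ∀ c : ℝ → V, IsSmoothCurve c →
      ContDiff ℝ ∞ fun p : ℝ × ℝ => α (p.1 • c p.2) (c p.2) := fun c hc =>
    IsSmoothMap.contDiff fun e he => by
      have h1 : ContDiff ℝ ∞ fun t => (e t).1 := isSmoothCurve_iff_contDiff.1 he.fst
      have h2 : ContDiff ℝ ∞ fun t => (e t).2 := isSmoothCurve_iff_contDiff.1 he.snd
      exact hs _ ((hc.smul_comp h1 h2).prodMk (hc.comp h2))
  -- The integral of `α` along the segment from `0` to `x`.
  refine ⟨fun x => ∫ t in (0 : ℝ)..1, α (t • x) x,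
    fun c hc => isSmoothCurve_intervalIntegral_param (hk c hc), fun x v => ?_⟩
  refine dirDeriv_eq (hasCurveDerivAt_iff_hasDerivAt.2 ?_)
  have hline := isSmoothCurve_line x v
  have hder := hasDerivAt_intervalIntegral_param (hk _ hline) 0
  have hψ : ContDiff ℝ ∞ fun t : ℝ => t * α (t • x) v :=
    contDiff_id.mul (isSmoothCurve_iff_contDiff.1
      (isSmoothMap_oneForm_apply hs v _ ((isSmoothCurve_const x).smul_comp contDiff_id contDiff_id)))
  -- Closedness turns the derivative of the integrand in direction `v` into the total derivative of
  -- `t * α (t • x) v`, whose integral over `[0, 1]` is `α x v`.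
  have hpt : ∀ t : ℝ, HasDerivAt (fun t : ℝ => t * α (t • x) v)
      (fderiv ℝ (fun p : ℝ × ℝ => α (p.1 • (x + p.2 • v)) (x + p.2 • v)) (t, 0) (0, 1)) t := by
    intro t
    have hd : ∀ w z, HasDerivAt (fun s : ℝ => α (t • x + s • w) z)
        (dirDeriv (fun x' => α x' z) (t • x) w) 0 := fun w z =>
      hasCurveDerivAt_iff_hasDerivAt.1 ((isSmoothMap_oneForm_apply hs z).hasCurveDerivAt _ w)
    have h1 : fderiv ℝ (fun p : ℝ × ℝ => α (p.1 • (x + p.2 • v)) (x + p.2 • v)) (t, 0) (0, 1)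
        = t * dirDeriv (fun x' => α x' x) (t • x) v + α (t • x) v := by
      have h2 : HasDerivAt (fun s : ℝ => α (t • (x + s • v)) (x + s • v))
          (fderiv ℝ (fun p : ℝ × ℝ => α (p.1 • (x + p.2 • v)) (x + p.2 • v)) (t, 0) (0, 1)) 0 :=
        (((hk _ hline).differentiable (by simp) (t, 0)).hasFDerivAt).comp_hasDerivAt (0 : ℝ)
          ((hasDerivAt_const (0 : ℝ) t).prodMk (hasDerivAt_id (0 : ℝ)))
      refine h2.unique ?_
      have hmul : HasDerivAt (fun s : ℝ => t * s) t 0 := by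
        simpa using (hasDerivAt_id (0 : ℝ)).const_mul t
      have hc : ∀ z, HasDerivAt (fun s : ℝ => α (t • x + (t * s) • v) z)
          (dirDeriv (fun x' => α x' z) (t • x) v * t) 0 := fun z =>
        HasDerivAt.comp (h₂ := fun s : ℝ => α (t • x + s • v) z) (0 : ℝ)
          (by simpa using hd v z) hmul
      -- The linearity of `α` in its vector argument splits off `s * α(·)v`, so only derivatives of
      -- scalar functions with a fixed vector argument occur.
      have h3 := (hc x).add ((hasDerivAt_id (0 : ℝ)).mul (hc v))
      refine (h3.congr_of_eventuallyEq (Eventually.of_forall fun s => ?_)).congr_deriv ?_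
      · simp [smul_add, smul_smul]
      · simp [mul_comm]
    rw [h1]
    have h4 : HasDerivAt (fun s : ℝ => α (s • x) v) (dirDeriv (fun x' => α x' v) (t • x) x) t := by
      have h5 := HasDerivAt.comp (h₂ := fun s : ℝ => α (t • x + s • x) v) t
        (by simpa using hd x v) ((hasDerivAt_id t).sub_const t)
      refine (h5.congr_of_eventuallyEq (Eventually.of_forall fun s => ?_)).congr_deriv
        (mul_one _)
      simp [← add_smul]
    refine ((hasDerivAt_id t).mul h4).congr_deriv ?_
    have h6 := hcl (t • x) v x
    simp only [extDeriv] at h6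
    simp only [id, one_mul]
    linear_combination -t * h6
  have hint := intervalIntegral.integral_eq_sub_of_hasDerivAt (a := 0) (b := 1)
    (fun t _ => hpt t) (Continuous.intervalIntegrable (by
      have h := (hk _ hline).continuous_fderiv (by simp)
      exact (h.comp (by fun_prop : Continuous fun t : ℝ => (t, (0 : ℝ)))).clm_apply
        continuous_const) _ _)
  rw [hint] at hder
  simpa using hder

theorem subsingleton_H1 : Subsingleton (H1 V) := by
  refine Submodule.Quotient.subsingleton_iff.2 (eq_top_iff.2 fun α _ => ?_)
  obtain ⟨f, hf, hd⟩ := exists_primitive_of_mem_closedOneForms α.2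
  exact ⟨α.2.1, f, hf, fun x v => (hd x v).symm⟩

end Poincare

end UnitaryMoment

namespace UnitaryMoment

/-! ## Weak symplectic geometry -/

section Symplectic

variable {V : Type*} [AddCommGroup V] [Module ℝ V] [TopologicalSpace V]
  [IsTopologicalAddGroup V] [ContinuousSMul ℝ V] {Ω : WeakSymplecticForm V}

/-- The functional `x ↦ Ω(x, y)`. -/
noncomputable def WeakSymplecticForm.formRight (Ω : WeakSymplecticForm V) (y : V) : V →L[ℝ] ℝ :=
  -Ω.form y

theorem WeakSymplecticForm.formRight_apply (Ω : WeakSymplecticForm V) (x y : V) :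
    Ω.formRight y x = Ω.form x y := by
  rw [Ω.skew x y]
  rfl

theorem WeakSymplecticForm.hasCurveDerivAt
    (hω : Continuous fun p : V × V => Ω.form p.1 p.2) {a b : ℝ → V} {u v : V} {t : ℝ}
    (ha : HasCurveDerivAt a u t) (hb : HasCurveDerivAt b v t) :
    HasCurveDerivAt (fun s => Ω.form (a s) (b s)) (Ω.form u (b t) + Ω.form (a t) v) t := by
  obtain ⟨p, hp, rfl, ha'⟩ := hasCurveDerivAt_iff_exists.1 ha
  obtain ⟨q, hq, rfl, hb'⟩ := hasCurveDerivAt_iff_exists.1 hb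
  have hcont : ∀ {c d : ℝ → V}, ContinuousAt c 0 → ContinuousAt d 0 →
      ContinuousAt (fun s => Ω.form (c s) (d s)) 0 := fun hc hd =>
    hω.continuousAt.comp (hc.prodMk hd)
  refine hasCurveDerivAt_iff_exists.2 ⟨fun s => Ω.form (p s) (b t) + Ω.form (a t) (q s)
    + s * Ω.form (p s) (q s), ?_, by simp, fun s => ?_⟩
  · exact ((hcont hp continuousAt_const).add (hcont continuousAt_const hq)).add
      (continuousAt_id.mul (hcont hp hq))
  · simp only [ha', hb', map_add, map_smul, add_apply, smul_apply, smul_eq_mul]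
    ring

theorem WeakSymplecticForm.isSmoothCurve
    (hω : Continuous fun p : V × V => Ω.form p.1 p.2) {a b : ℝ → V}
    (ha : IsSmoothCurve a) (hb : IsSmoothCurve b) :
    IsSmoothCurve fun t => Ω.form (a t) (b t) := by
  -- By the product rule, finite sums of such pairings are closed under differentiation.
  let S : Set (ℝ → ℝ) := {e | ∃ a b : ℝ → V, IsSmoothCurve a ∧ IsSmoothCurve b ∧
    e = fun t => Ω.form (a t) (b t)}
  refine IsSmoothCurve.of_forall_exists_deriv (P := fun e => e ∈ AddSubmonoid.closure S) ?_
    (AddSubmonoid.subset_closure ⟨a, b, ha, hb, rfl⟩)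
  intro e he
  induction he using AddSubmonoid.closure_induction with
  | mem e he =>
    obtain ⟨a, b, ha, hb, rfl⟩ := he
    obtain ⟨a', ha', had⟩ := ha.exists_smooth_deriv
    obtain ⟨b', hb', hbd⟩ := hb.exists_smooth_deriv
    exact ⟨hω.comp (ha.continuous.prodMk hb.continuous),
      (fun t => Ω.form (a' t) (b t)) + fun t => Ω.form (a t) (b' t),
      add_mem (AddSubmonoid.subset_closure ⟨_, _, ha', hb, rfl⟩)
        (AddSubmonoid.subset_closure ⟨_, _, ha, hb', rfl⟩),
      fun t => WeakSymplecticForm.hasCurveDerivAt hω (had t) (hbd t)⟩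
  | zero =>
    exact ⟨continuous_const, 0, zero_mem _, fun t => by
      simp [HasCurveDerivAt]⟩
  | add e f _ _ he hf =>
    obtain ⟨he0, e', he', he1⟩ := he
    obtain ⟨hf0, f', hf', hf1⟩ := hf
    exact ⟨he0.add hf0, e' + f', add_mem he' hf', fun t =>
      hasCurveDerivAt_iff_hasDerivAt.2 ((hasCurveDerivAt_iff_hasDerivAt.1 (he1 t)).add
        (hasCurveDerivAt_iff_hasDerivAt.1 (hf1 t)))⟩

variable [T2Space V]

theorem dirDeriv_form_left {ξ : V → V} (hξ : IsSmoothMap ξ) (x u v : V) :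
    dirDeriv (fun x' => Ω.form (ξ x') v) x u = Ω.form (dirDeriv ξ x u) v := by
  simp only [← Ω.formRight_apply]
  exact dirDeriv_eq ((hξ.hasCurveDerivAt x u).clm (Ω.formRight v))

/-- The conditions of higher order are automatic: `dⁿ⁺¹f(x)(y₁, y)` is the `n`-th derivative of
`Ω(ξ(·), y₁)`, and the continuous functional `Ω(·, y₁)` commutes with differentiation. So `dⁿξ` is
the required representing map. -/
theorem mem_smoothStar_iff (hV : HasSmoothPartialDerivs V) {f : V → ℝ} :
    f ∈ smoothStar Ω ↔ IsSmoothMap f ∧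
      ∃ ξ : V → V, IsSmoothMap ξ ∧ ∀ x v, dirDeriv f x v = Ω.form (ξ x) v := by
  constructor
  · rintro ⟨hf, hZ⟩
    obtain ⟨Z, hZs, hZf⟩ := hZ 0
    exact ⟨hf, fun x => Z (x, 0), fun c hc => hZs _ (hc.prodMk (isSmoothCurve_const 0)),
      fun x v => hZf x 0 v⟩
  · rintro ⟨hf, ξ, hξ, hfξ⟩
    refine ⟨hf, fun n => ⟨_, hξ.iterDeriv hV n, fun x y y₁ => ?_⟩⟩
    have h1 : iterDeriv f (n + 1) x (Fin.cons y₁ y) = dirDeriv (fun x' => iterDeriv f n x' y) x y₁ := by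
      simp [iterDeriv]
    have h2 : (fun x' => dirDeriv f x' y₁) = fun x' => Ω.formRight y₁ (ξ x') :=
      funext fun x' => by rw [hfξ, Ω.formRight_apply]
    rw [h1, ← hf.iterDeriv_dirDeriv, h2, iterDeriv_clm hV hξ, Ω.formRight_apply]

/-- Both sides are second derivatives of `f`, so this is Schwarz's theorem. It says that Hamiltonian
fields are symplectic. -/
theorem form_dirDeriv_symm_of_dirDeriv_eq {f : V → ℝ} (hf : IsSmoothMap f) {ξ : V → V}
    (hξ : IsSmoothMap ξ) (h : ∀ x v, dirDeriv f x v = Ω.form (ξ x) v) (x u v : V) :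
    Ω.form (dirDeriv ξ x u) v = Ω.form (dirDeriv ξ x v) u := by
  rw [← dirDeriv_form_left hξ, ← dirDeriv_form_left hξ]
  simp only [← h]
  exact hf.dirDeriv_comm x v u

/-- As `Ω` is constant, the first term of its Lie derivative vanishes; skew symmetry rewrites the
other two. -/
theorem mem_symplecticFields_iff {ξ : V → V} : ξ ∈ symplecticFields Ω ↔
    IsSmoothMap ξ ∧ ∀ x u v, Ω.form (dirDeriv ξ x u) v = Ω.form (dirDeriv ξ x v) u := by
  refine and_congr_right fun _ => forall_congr' fun x => forall_congr' fun u =>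
    forall_congr' fun v => ?_
  rw [lieDeriv, dirDeriv_const, zero_add, Ω.skew u, ← sub_eq_add_neg, sub_eq_zero]

/-- By symmetry the direction can be moved into the second slot of `Ω`, where the dependence is
linear; injectivity of `Ω` then gives the claim. The biadditivity of the Lie bracket rests on this.
-/
theorem dirDeriv_mem_symplecticFields_add {ξ : V → V} (hξ : ξ ∈ symplecticFields Ω) (x u v : V) :
    dirDeriv ξ x (u + v) = dirDeriv ξ x u + dirDeriv ξ x v := by
  have h := (mem_symplecticFields_iff.1 hξ).2
  refine Ω.injective (ContinuousLinearMap.ext fun w => ?_)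
  rw [h, map_add, map_add, add_apply, h x w u, h x w v]

/-- For symplectic fields `ξ` and `η`, the function `Ω(η, ξ)` is a Hamiltonian of `[ξ, η]`. -/
theorem dirDeriv_form_of_mem_symplecticFields (hω : Continuous fun p : V × V => Ω.form p.1 p.2)
    {ξ η : V → V} (hξ : ξ ∈ symplecticFields Ω) (hη : η ∈ symplecticFields Ω) (x v : V) :
    dirDeriv (fun x => Ω.form (η x) (ξ x)) x v
      = Ω.form (dirDeriv η x (ξ x) - dirDeriv ξ x (η x)) v := by
  obtain ⟨hξs, hξ'⟩ := mem_symplecticFields_iff.1 hξ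
  obtain ⟨hηs, hη'⟩ := mem_symplecticFields_iff.1 hη
  have hη0 : η (x + (0 : ℝ) • v) = η x := by rw [zero_smul, add_zero]
  have hξ0 : ξ (x + (0 : ℝ) • v) = ξ x := by rw [zero_smul, add_zero]
  have h := WeakSymplecticForm.hasCurveDerivAt hω (hηs.hasCurveDerivAt x v)
    (hξs.hasCurveDerivAt x v)
  rw [hη0, hξ0] at h
  have h' : dirDeriv (fun x => Ω.form (η x) (ξ x)) x v
      = Ω.form (dirDeriv η x v) (ξ x) + Ω.form (η x) (dirDeriv ξ x v) := dirDeriv_eq h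
  rw [h', map_sub, sub_apply, hη' x (ξ x) v, hξ' x (η x) v, Ω.skew (η x), sub_eq_add_neg]

theorem isSmoothMap_form (hω : Continuous fun p : V × V => Ω.form p.1 p.2)
    {U : Type*} [AddCommGroup U] [Module ℝ U] [TopologicalSpace U] {ξ η : U → V}
    (hξ : IsSmoothMap ξ) (hη : IsSmoothMap η) : IsSmoothMap fun x => Ω.form (ξ x) (η x) :=
  fun c hc => WeakSymplecticForm.isSmoothCurve hω (hξ c hc) (hη c hc)

theorem isSmoothMap_bracket (hV : HasSmoothPartialDerivs V) {ξ η : V → V}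
    (hξ : IsSmoothMap ξ) (hη : IsSmoothMap η) :
    IsSmoothMap fun x => dirDeriv η x (ξ x) - dirDeriv ξ x (η x) := by
  have h := (hη.dirDeriv_comp hV isSmoothMap_id hξ).add
    ((hξ.dirDeriv_comp hV isSmoothMap_id hη).smul (-1))
  convert h using 2 with x
  simp [sub_eq_add_neg]

theorem form_mem_smoothStar (hV : HasSmoothPartialDerivs V)
    (hω : Continuous fun p : V × V => Ω.form p.1 p.2)
    {ξ η : V → V} (hξ : ξ ∈ symplecticFields Ω) (hη : η ∈ symplecticFields Ω) :
    (fun x => Ω.form (η x) (ξ x)) ∈ smoothStar Ω :=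
  (mem_smoothStar_iff hV).2 ⟨isSmoothMap_form hω hη.1 hξ.1, _,
    isSmoothMap_bracket hV hξ.1 hη.1, dirDeriv_form_of_mem_symplecticFields hω hξ hη⟩

/-- The bracket has the Hamiltonian `Ω(η, ξ)`, and Hamiltonian fields are symplectic. -/
theorem bracket_mem_symplecticFields (hV : HasSmoothPartialDerivs V)
    (hω : Continuous fun p : V × V => Ω.form p.1 p.2)
    {ξ η : V → V} (hξ : ξ ∈ symplecticFields Ω) (hη : η ∈ symplecticFields Ω) :
    (fun x => dirDeriv η x (ξ x) - dirDeriv ξ x (η x)) ∈ symplecticFields Ω :=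
  mem_symplecticFields_iff.2 ⟨isSmoothMap_bracket hV hξ.1 hη.1,
    form_dirDeriv_symm_of_dirDeriv_eq (isSmoothMap_form hω hη.1 hξ.1)
      (isSmoothMap_bracket hV hξ.1 hη.1) (dirDeriv_form_of_mem_symplecticFields hω hξ hη)⟩

theorem exists_grad (hV : HasSmoothPartialDerivs V) (f : smoothStar Ω) :
    ∃ ξ : symplecticFields Ω, ∀ x v, dirDeriv f.1 x v = Ω.form (ξ.1 x) v := by
  obtain ⟨hf, ξ, hξ, h⟩ := (mem_smoothStar_iff hV).1 f.2
  exact ⟨⟨ξ, mem_symplecticFields_iff.2 ⟨hξ, form_dirDeriv_symm_of_dirDeriv_eq hf hξ h⟩⟩, h⟩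

theorem eq_of_form_eq {ξ η : V → V} (h : ∀ x v, Ω.form (ξ x) v = Ω.form (η x) v) : ξ = η :=
  funext fun x => Ω.injective (ContinuousLinearMap.ext (h x))

/-- The Hamiltonian vector field `grad f = Ω̌⁻¹ ∘ df`. -/
noncomputable def grad (Ω : WeakSymplecticForm V) (hV : HasSmoothPartialDerivs V) :
    smoothStar Ω →ₗ[ℝ] symplecticFields Ω where
  toFun f := (exists_grad hV f).choose
  map_add' f g := Subtype.ext <| eq_of_form_eq fun x v => by
    rw [← (exists_grad hV (f + g)).choose_spec]
    change dirDeriv (f.1 + g.1) x v = Ω.form (_ + _) v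
    rw [IsSmoothMap.dirDeriv_add f.2.1 g.2.1, map_add, add_apply,
      (exists_grad hV f).choose_spec, (exists_grad hV g).choose_spec]
  map_smul' r f := Subtype.ext <| eq_of_form_eq fun x v => by
    rw [← (exists_grad hV (r • f)).choose_spec]
    change dirDeriv (r • f.1) x v = Ω.form (r • _) v
    rw [IsSmoothMap.dirDeriv_smul r f.2.1, map_smul, smul_apply,
      (exists_grad hV f).choose_spec]

theorem form_grad (hV : HasSmoothPartialDerivs V) (f : smoothStar Ω) (x v : V) :
    Ω.form ((grad Ω hV f).1 x) v = dirDeriv f.1 x v :=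
  ((exists_grad hV f).choose_spec x v).symm

theorem grad_eq_of_form_eq (hV : HasSmoothPartialDerivs V) {f : smoothStar Ω}
    {ξ : symplecticFields Ω} (h : ∀ x v, dirDeriv f.1 x v = Ω.form (ξ.1 x) v) :
    grad Ω hV f = ξ :=
  Subtype.ext <| eq_of_form_eq fun x v => by rw [form_grad, h]

/-- The Poisson bracket `{f, g} = Ω(grad g, grad f)`. -/
noncomputable def poisson (hV : HasSmoothPartialDerivs V)
    (hω : Continuous fun p : V × V => Ω.form p.1 p.2) :
    smoothStar Ω →ₗ[ℝ] smoothStar Ω →ₗ[ℝ] smoothStar Ω :=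
  LinearMap.mk₂ ℝ
    (fun f g => ⟨_, form_mem_smoothStar hV hω (grad Ω hV f).2 (grad Ω hV g).2⟩)
    (fun f₁ f₂ g => Subtype.ext <| funext fun x => by
      have h : (grad Ω hV (f₁ + f₂)).1 x = (grad Ω hV f₁).1 x + (grad Ω hV f₂).1 x := by
        rw [map_add]; rfl
      change Ω.form _ ((grad Ω hV (f₁ + f₂)).1 x) = Ω.form _ _ + Ω.form _ _
      rw [h, map_add])
    (fun r f g => Subtype.ext <| funext fun x => by
      have h : (grad Ω hV (r • f)).1 x = r • (grad Ω hV f).1 x := by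
        rw [map_smul]; rfl
      change Ω.form _ ((grad Ω hV (r • f)).1 x) = r • Ω.form _ _
      rw [h, map_smul])
    (fun f g₁ g₂ => Subtype.ext <| funext fun x => by
      have h : (grad Ω hV (g₁ + g₂)).1 x = (grad Ω hV g₁).1 x + (grad Ω hV g₂).1 x := by
        rw [map_add]; rfl
      change Ω.form ((grad Ω hV (g₁ + g₂)).1 x) _ = Ω.form _ _ + Ω.form _ _
      rw [h, map_add, add_apply])
    (fun r f g => Subtype.ext <| funext fun x => by
      have h : (grad Ω hV (r • g)).1 x = r • (grad Ω hV g).1 x := by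
        rw [map_smul]; rfl
      change Ω.form ((grad Ω hV (r • g)).1 x) _ = r • Ω.form _ _
      rw [h, map_smul, smul_apply])

theorem poisson_apply (hV : HasSmoothPartialDerivs V)
    (hω : Continuous fun p : V × V => Ω.form p.1 p.2) (f g : smoothStar Ω) (x : V) :
    (poisson hV hω f g).1 x = Ω.form ((grad Ω hV g).1 x) ((grad Ω hV f).1 x) := rfl

/-- The Lie bracket `[ξ, η](x) = dη(x)ξ(x) - dξ(x)η(x)`. -/
noncomputable def lieBracket (hV : HasSmoothPartialDerivs V)
    (hω : Continuous fun p : V × V => Ω.form p.1 p.2) :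
    symplecticFields Ω →ₗ[ℝ] symplecticFields Ω →ₗ[ℝ] symplecticFields Ω :=
  LinearMap.mk₂ ℝ (fun ξ η => ⟨_, bracket_mem_symplecticFields hV hω ξ.2 η.2⟩)
    (fun ξ₁ ξ₂ η => Subtype.ext <| funext fun x => by
      change dirDeriv η.1 x (ξ₁.1 x + ξ₂.1 x) - dirDeriv (ξ₁.1 + ξ₂.1) x (η.1 x)
        = (dirDeriv η.1 x (ξ₁.1 x) - dirDeriv ξ₁.1 x (η.1 x))
          + (dirDeriv η.1 x (ξ₂.1 x) - dirDeriv ξ₂.1 x (η.1 x))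
      rw [dirDeriv_mem_symplecticFields_add η.2, IsSmoothMap.dirDeriv_add ξ₁.2.1 ξ₂.2.1]
      abel)
    (fun r ξ η => Subtype.ext <| funext fun x => by
      change dirDeriv η.1 x (r • ξ.1 x) - dirDeriv (r • ξ.1) x (η.1 x)
        = r • (dirDeriv η.1 x (ξ.1 x) - dirDeriv ξ.1 x (η.1 x))
      rw [dirDeriv_smul_dir η.2.1, IsSmoothMap.dirDeriv_smul r ξ.2.1, smul_sub])
    (fun ξ η₁ η₂ => Subtype.ext <| funext fun x => by
      change dirDeriv (η₁.1 + η₂.1) x (ξ.1 x) - dirDeriv ξ.1 x (η₁.1 x + η₂.1 x)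
        = (dirDeriv η₁.1 x (ξ.1 x) - dirDeriv ξ.1 x (η₁.1 x))
          + (dirDeriv η₂.1 x (ξ.1 x) - dirDeriv ξ.1 x (η₂.1 x))
      rw [dirDeriv_mem_symplecticFields_add ξ.2, IsSmoothMap.dirDeriv_add η₁.2.1 η₂.2.1]
      abel)
    (fun r ξ η => Subtype.ext <| funext fun x => by
      change dirDeriv (r • η.1) x (ξ.1 x) - dirDeriv ξ.1 x (r • η.1 x)
        = r • (dirDeriv η.1 x (ξ.1 x) - dirDeriv ξ.1 x (η.1 x))
      rw [dirDeriv_smul_dir ξ.2.1, IsSmoothMap.dirDeriv_smul r η.2.1, smul_sub])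

theorem lieBracket_apply (hV : HasSmoothPartialDerivs V)
    (hω : Continuous fun p : V × V => Ω.form p.1 p.2) (ξ η : symplecticFields Ω) (x : V) :
    (lieBracket hV hω ξ η).1 x = dirDeriv η.1 x (ξ.1 x) - dirDeriv ξ.1 x (η.1 x) := rfl

theorem grad_poisson (hV : HasSmoothPartialDerivs V)
    (hω : Continuous fun p : V × V => Ω.form p.1 p.2) (f g : smoothStar Ω) :
    grad Ω hV (poisson hV hω f g) = lieBracket hV hω (grad Ω hV f) (grad Ω hV g) :=
  grad_eq_of_form_eq hV
    (dirDeriv_form_of_mem_symplecticFields hω (grad Ω hV f).2 (grad Ω hV g).2)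

theorem isLieBracket_poisson (hV : HasSmoothPartialDerivs V)
    (hω : Continuous fun p : V × V => Ω.form p.1 p.2) : IsLieBracket (poisson hV hω) := by
  refine ⟨fun f => Subtype.ext <| funext fun x => Ω.self_eq_zero _, fun f g h =>
    Subtype.ext <| funext fun x => ?_⟩
  change (poisson hV hω f (poisson hV hω g h)).1 x + (poisson hV hω g (poisson hV hω h f)).1 x
    + (poisson hV hω h (poisson hV hω f g)).1 x = 0
  -- Since `grad` maps the inner brackets to Lie brackets, the Jacobi sum has six terms `± Ω(d(grad
  -- a)(grad b), grad c)`. The two with the same `a` have opposite signs and `b`, `c` exchanged, so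
  -- the symmetry cancels them.
  have hsymm := fun k : smoothStar Ω => (mem_symplecticFields_iff.1 (grad Ω hV k).2).2 x
  simp only [poisson_apply, grad_poisson, lieBracket_apply, map_sub, sub_apply]
  rw [hsymm h ((grad Ω hV g).1 x), hsymm g ((grad Ω hV h).1 x), hsymm f ((grad Ω hV h).1 x)]
  ring

/-- The `1`-form `i_ξ Ω`. -/
noncomputable def interior (hω : Continuous fun p : V × V => Ω.form p.1 p.2) :
    symplecticFields Ω →ₗ[ℝ] closedOneForms V where
  toFun ξ := ⟨fun x => Ω.form (ξ.1 x),
    isSmoothMap_form hω (fun _ hc => ξ.2.1 _ hc.fst) (fun _ hc => hc.snd), fun x u v => by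
      change dirDeriv (fun x => Ω.form (ξ.1 x) v) x u - dirDeriv (fun x => Ω.form (ξ.1 x) u) x v = 0
      rw [dirDeriv_form_left ξ.2.1, dirDeriv_form_left ξ.2.1,
        (mem_symplecticFields_iff.1 ξ.2).2, sub_self]⟩
  map_add' ξ η := Subtype.ext <| funext fun x => map_add Ω.form (ξ.1 x) (η.1 x)
  map_smul' r ξ := Subtype.ext <| funext fun x => map_smul Ω.form r (ξ.1 x)

/-- `i_ξ Ω` is closed because `ξ` is symplectic. A primitive from the Poincaré lemma has the smooth
gradient `ξ`, and the first order criterion puts it into `smoothStar Ω`. -/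
theorem grad_surjective (hV : HasSmoothPartialDerivs V)
    (hω : Continuous fun p : V × V => Ω.form p.1 p.2) :
    Function.Surjective (grad Ω hV) := by
  intro ξ
  obtain ⟨f, hf, h⟩ := exists_primitive_of_mem_closedOneForms (interior hω ξ).2
  exact ⟨⟨f, (mem_smoothStar_iff hV).2 ⟨hf, ξ.1, ξ.2.1, h⟩⟩, grad_eq_of_form_eq hV h⟩

/-- The Jacobi identity is inherited from the Poisson bracket through the surjective homomorphism
`grad`, without computing second derivatives of vector fields. -/
theorem isLieBracket_lieBracket (hV : HasSmoothPartialDerivs V)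
    (hω : Continuous fun p : V × V => Ω.form p.1 p.2) : IsLieBracket (lieBracket hV hω) := by
  refine ⟨fun ξ => Subtype.ext <| funext fun x => sub_self _, fun ξ η ζ => ?_⟩
  obtain ⟨f, rfl⟩ := grad_surjective hV hω ξ
  obtain ⟨g, rfl⟩ := grad_surjective hV hω η
  obtain ⟨h, rfl⟩ := grad_surjective hV hω ζ
  simp only [← grad_poisson, ← map_add]
  rw [(isLieBracket_poisson hV hω).2, map_zero]

theorem H0_le_smoothStar (hV : HasSmoothPartialDerivs V) : H0 V ≤ smoothStar Ω :=
  fun _ hf => (mem_smoothStar_iff hV).2 ⟨hf.1, 0, isSmoothMap_const 0, fun x v => by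
    simp [hf.2 x v]⟩

/-- The representation enters the theorem only through `hV` and `hω`. As `H¹` vanishes, exactness at
the symplectic fields is the surjectivity of `grad`, and all statements on values of `γ` are
trivial. -/
theorem exists_exact_sequence (Ω : WeakSymplecticForm V) (hV : HasSmoothPartialDerivs V)
    (hω : Continuous fun p : V × V => Ω.form p.1 p.2) :
    ∃ (grad : smoothStar Ω →ₗ[ℝ] symplecticFields Ω)
      (poisson : smoothStar Ω →ₗ[ℝ] smoothStar Ω →ₗ[ℝ] smoothStar Ω)
      (lie : symplecticFields Ω →ₗ[ℝ] symplecticFields Ω →ₗ[ℝ] symplecticFields Ω)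
      (ι : H0 V →ₗ[ℝ] smoothStar Ω)
      (γ : symplecticFields Ω →ₗ[ℝ] H1 V),
      (∀ (f : smoothStar Ω) (x z : V),
        (∀ y : V, dirDeriv f.1 x y = Ω.form z y) ↔ z = (grad f).1 x) ∧
      (∀ (f g : smoothStar Ω) (x : V),
        (poisson f g).1 x = dirDeriv g.1 x ((grad f).1 x) ∧
        (poisson f g).1 x = Ω.form ((grad g).1 x) ((grad f).1 x)) ∧
      IsLieBracket poisson ∧
      (∀ (ξ η : symplecticFields Ω) (x : V),
        (lie ξ η).1 x = dirDeriv η.1 x (ξ.1 x) - dirDeriv ξ.1 x (η.1 x)) ∧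
      IsLieBracket lie ∧
      (∀ h : H0 V, (ι h).1 = h.1) ∧
      (∀ ξ : symplecticFields Ω, ∃ α : closedOneForms V,
        (∀ x : V, α.1 x = Ω.form (ξ.1 x)) ∧ γ ξ = Submodule.Quotient.mk α) ∧
      IsLieHom 0 poisson ι ∧ IsLieHom poisson lie grad ∧ IsLieHom lie 0 γ ∧
      Function.Injective ι ∧ Function.Exact ι grad ∧ Function.Exact grad γ ∧
      Subsingleton (H1 V) := by
  have hH1 : Subsingleton (H1 V) := subsingleton_H1
  refine ⟨grad Ω hV, poisson hV hω, lieBracket hV hω,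
    Submodule.inclusion (H0_le_smoothStar hV), (Submodule.mkQ _).comp (interior hω),
    fun f x z => ⟨fun h => ?_, ?_⟩, fun f g x => ⟨?_, rfl⟩, isLieBracket_poisson hV hω,
    fun _ _ _ => rfl, isLieBracket_lieBracket hV hω, fun _ => rfl,
    fun ξ => ⟨interior hω ξ, fun _ => rfl, rfl⟩, fun f g => ?_, grad_poisson hV hω,
    fun _ _ => Subsingleton.elim _ _, Submodule.inclusion_injective _, fun f => ⟨fun h => ?_, ?_⟩,
    fun ξ => ⟨fun _ => grad_surjective hV hω ξ, fun _ => Subsingleton.elim _ _⟩, hH1⟩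
  · exact Ω.injective (ContinuousLinearMap.ext fun y => by rw [form_grad, h])
  · rintro rfl y
    rw [form_grad]
  · rw [poisson_apply, form_grad]
  · refine Subtype.ext <| funext fun x => ?_
    rw [poisson_apply, form_grad]
    exact (g.2.2 x _).symm
  · refine ⟨⟨f.1, f.2.1, fun x v => ?_⟩, rfl⟩
    rw [← form_grad hV f, h]
    simp
  · rintro ⟨h, rfl⟩
    refine grad_eq_of_form_eq hV fun x v => ?_
    exact (h.2.2 x v).trans (by simp)

end Symplectic

/-! ### Application to the space of smooth vectors -/

theorem SmoothVectors.continuous_symplecticForm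
    {E : Type*} [NormedAddCommGroup E] [NormedSpace ℝ E]
    {G : Type*} [Group G] [TopologicalSpace G] [ChartedSpace E G] [IsManifold 𝓘(ℝ, E) ∞ G]
    {H : Type*} [NormedAddCommGroup H] [InnerProductSpace ℂ H] [CompleteSpace H]
    (ρ : G →* unitary (H →L[ℂ] H)) :
    Continuous fun p : SmoothVectors E ρ × SmoothVectors E ρ =>
      (symplecticForm ρ).form p.1 p.2 := by
  simp only [symplecticForm_apply]
  have h := continuous_incl (E := E) ρ
  fun_prop

end UnitaryMoment

theorem theorem2p9
    {E : Type*} [NormedAddCommGroup E] [NormedSpace ℝ E] [FiniteDimensional ℝ E]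
    {G : Type*} [Group G] [TopologicalSpace G] [SecondCountableTopology G]
    [ChartedSpace E G] [LieGroup 𝓘(ℝ, E) ∞ G]
    {H : Type*} [NormedAddCommGroup H] [InnerProductSpace ℂ H] [CompleteSpace H]
    (ρ : G →* unitary (H →L[ℂ] H))
    (hρ : ∀ x : H, Continuous fun g : G => (ρ g : H →L[ℂ] H) x) :
    let V := SmoothVectors E ρ
    let Ω : WeakSymplecticForm V := SmoothVectors.symplecticForm ρ
    ∃ (grad : smoothStar Ω →ₗ[ℝ] symplecticFields Ω)
      (poisson : smoothStar Ω →ₗ[ℝ] smoothStar Ω →ₗ[ℝ] smoothStar Ω)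
      (lie : symplecticFields Ω →ₗ[ℝ] symplecticFields Ω →ₗ[ℝ] symplecticFields Ω)
      (ι : H0 V →ₗ[ℝ] smoothStar Ω)
      (γ : symplecticFields Ω →ₗ[ℝ] H1 V),
      -- with `Ω` the symplectic form `ω = Im ⟨·, ·⟩`: `grad f = ω̌⁻¹ ∘ df`: the vector `grad f (x)` is the one and only preimage of `df(x)`
      (∀ (f : smoothStar Ω) (x z : V),
        (∀ y : V, dirDeriv f.1 x y = Ω.form z y) ↔ z = (grad f).1 x) ∧
      -- the Poisson bracket `{f, g} = ω(grad g, grad f) = dg(grad f)` is a Lie bracket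
      (∀ (f g : smoothStar Ω) (x : V),
        (poisson f g).1 x = dirDeriv g.1 x ((grad f).1 x) ∧
        (poisson f g).1 x = Ω.form ((grad g).1 x) ((grad f).1 x)) ∧
      IsLieBracket poisson ∧
      -- the Lie bracket of vector fields
      (∀ (ξ η : symplecticFields Ω) (x : V),
        (lie ξ η).1 x = dirDeriv η.1 x (ξ.1 x) - dirDeriv ξ.1 x (η.1 x)) ∧
      IsLieBracket lie ∧
      -- the inclusion `ι`, and `γ(ξ) = [i_ξ ω]`
      (∀ h : H0 V, (ι h).1 = h.1) ∧
      (∀ ξ : symplecticFields Ω, ∃ α : closedOneForms V,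
        (∀ x : V, α.1 x = Ω.form (ξ.1 x)) ∧ γ ξ = Submodule.Quotient.mk α) ∧
      -- `ι`, `grad`, `γ` are Lie algebra homomorphisms, with the zero brackets on `H⁰` and `H¹`
      IsLieHom 0 poisson ι ∧ IsLieHom poisson lie grad ∧ IsLieHom lie 0 γ ∧
      -- `0 → H⁰ → C^∞_* → 𝔛_ω → H¹ = 0` is exact
      Function.Injective ι ∧ Function.Exact ι grad ∧ Function.Exact grad γ ∧
      Subsingleton (H1 V) := by
  intro V Ω
  exact exists_exact_sequence Ω (SmoothVectors.hasSmoothPartialDerivs ρ)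
    (SmoothVectors.continuous_symplecticForm ρ)
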